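/- Let $G$ be a locally compact (Hausdorff) abelian group with Haar measure $dx$; write $|A|$ for the Haar measure of $A$. By a generating neighbourhood we mean a relatively compact neighbourhood $U$ of the identity with $G=\bigcup_n U^n$. Assume that $G$ is compactly generated of polynomial growth, i.e. that for some generating neighbourhood $U$ and some constants $C,Q$ one has $|U^n|\le Cn^Q$ for all $n\ge 1$. Let $1<p<\infty$, $\frac1p+\frac1q=1$, and let $\omega:G\to[1,\infty)$ be a measurable function (weight) satisfying (LPAlg), that is, for all $x,y\in G$: $$\omega(xy)\le\omega(x)\omega(y),\qquad \omega(x^{-1})=\omega(x),\qquad (\omega^{-q}*\omega^{-q})(x)=\int_G\omega(y)^{-q}\,\omega(y^{-1}x)^{-q}\,dy\le\omega(x)^{-q}.$$ Say that $\omega$ satisfies condition (S) if $\lim_{n\to\infty}\sup_{x\in U^n}\omega(x)^{1/n}=1$ for every generating neighbourhood $U$. Let $L^p(G,\omega)$ be the Banach space of (classes of) measurable functions $f:G\to\mathbb C$ with $\|f\|_{p,\omega}=\big(\int_G|f(x)|^p\omega(x)^p\,dx\big)^{1/p}<\infty$. (a) For every generating neighbourhood $U$, with $|x|_U=\inf\{n\ge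 1 : x\in U^n\}$, condition (S) holds if and only if for every $\varepsilon>0$ there is a constant $C_\varepsilon$ with $\omega(x)\le C_\varepsilon e^{\varepsilon|x|_U}$ for all $x\in G$. (b) If $\omega$ satisfies condition (S), then $L^p(G,\omega)$, with convolution $(f*g)(x)=\int_G f(y)g(y^{-1}x)\,dy$ as product (the integral converges absolutely for almost every $x$) and the involution $f^*(x)=\overline{f(x^{-1})}$, is a Banach $*$-algebra: $\|f*g\|_{p,\omega}\le\|f\|_{p,\omega}\|g\|_{p,\omega}$ and $\|f^*\|_{p,\omega}=\|f\|_{p,\omega}$. Moreover it is symmetric: for every $f\in L^p(G,\omega)$, the spectrum of $f^* * f$ is contained in $[0,\infty)$, where the spectrum is taken in the unitization if $L^p(G,\omega)$ has no unit. -/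

import Mathlib

open MeasureTheory Filter Topology Set
open scoped ENNReal Pointwise

noncomputable section

/-! ## Groups of polynomial growth and word length -/

/-- `U` is a relatively compact generating neighbourhood of the identity: `G = ⋃ₙ Uⁿ`, where `Uⁿ`
is the set of products of `n` elements of `U`. -/
structure IsGeneratingNhd {G : Type*} [TopologicalSpace G] [Group G] (U : Set G) : Prop where
  mem_nhds : U ∈ 𝓝 (1 : G)
  relativelyCompact : IsCompact (closure U)
  generates : ⋃ n : ℕ, U ^ n = Set.univ

/-- `G` is compactly generated of polynomial growth: some relatively compact generating
neighbourhood `U` of the identity satisfies `|Uⁿ| ≤ C n^Q` for all `n ≥ 1`. -/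
def HasPolynomialGrowth {G : Type*} [TopologicalSpace G] [Group G] [MeasurableSpace G]
    (μ : Measure G) : Prop :=
  ∃ U : Set G, IsGeneratingNhd U ∧ ∃ C Q : ℝ, ∀ n : ℕ, 1 ≤ n →
    μ (U ^ n) ≤ ENNReal.ofReal (C * (n : ℝ) ^ Q)

/-- The word length `|x|_U = inf {n ≥ 1 | x ∈ Uⁿ}`. -/
def wordLength {G : Type*} [Group G] (U : Set G) (x : G) : ℕ :=
  sInf {n : ℕ | 1 ≤ n ∧ x ∈ U ^ n}

/-! ## Weights -/

/-- The conditions (LPAlg) on a weight `ω : G → [1, ∞)`, with `q` the exponent conjugate to `p`. -/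
structure IsLPAlgWeight {G : Type*} [Group G] [MeasurableSpace G] (μ : Measure G) (q : ℝ)
    (ω : G → ℝ) : Prop where
  measurable : Measurable ω
  one_le : ∀ x, 1 ≤ ω x
  submultiplicative : ∀ x y, ω (x * y) ≤ ω x * ω y
  symmetric : ∀ x, ω x⁻¹ = ω x
  mlconvolution_le : ∀ x,
    mlconvolution (fun y => ENNReal.ofReal (ω y ^ (-q))) (fun y => ENNReal.ofReal (ω y ^ (-q))) μ x
      ≤ ENNReal.ofReal (ω x ^ (-q))

/-- Condition (S): `lim_{n → ∞} sup_{x ∈ Uⁿ} ω(x)^{1/n} = 1` for every relatively compact generating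
neighbourhood `U` of the identity. The supremum is taken in `[0, ∞]`, so an unbounded `ω` on `Uⁿ`
gives the value `∞`. -/
def ConditionS {G : Type*} [TopologicalSpace G] [Group G] (ω : G → ℝ) : Prop :=
  ∀ U : Set G, IsGeneratingNhd U →
    Tendsto (fun n : ℕ => ⨆ x ∈ U ^ n, ENNReal.ofReal (ω x ^ (1 / (n : ℝ)))) atTop (𝓝 1)

/-! ## The weighted space `L^p(G, ω)` -/

/-- The measure `ω^p dμ`, so that `∫ |f|^p ω^p dμ` is the `p`-th power of the norm of `f`. -/
def weightedMeasure {G : Type*} [MeasurableSpace G] (μ : Measure G) (ω : G → ℝ) (p : ℝ) :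
    Measure G :=
  μ.withDensity fun x => ENNReal.ofReal (ω x ^ p)

/-- The Banach space `L^p(G, ω)` of (classes of) measurable `f : G → ℂ` with
`‖f‖ = (∫ |f|^p ω^p dμ)^{1/p} < ∞`. This is not an abbreviation, so that the
pointwise operations on Mathlib's `Lp` spaces do not interfere with convolution and involution. -/
def WeightedLp {G : Type*} [MeasurableSpace G] (μ : Measure G) (ω : G → ℝ) (p : ℝ) : Type _ :=
  Lp ℂ (ENNReal.ofReal p) (weightedMeasure μ ω p)

theorem fact_one_le_ofReal (p : ℝ) [hp : Fact (1 < p)] : Fact (1 ≤ ENNReal.ofReal p) :=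
  ⟨ENNReal.one_le_ofReal.mpr hp.out.le⟩

/-- The convolution `(f * g)(x) = ∫ f(y) g(y⁻¹x) dy`. -/
def groupConvolution {G : Type*} [Group G] [MeasurableSpace G] (μ : Measure G) (f g : G → ℂ)
    (x : G) : ℂ :=
  ∫ y, f y * g (y⁻¹ * x) ∂μ

/-- The involution: `f^*(x)` is the complex conjugate of `f(x⁻¹)`. -/
def groupInvolution {G : Type*} [Group G] (f : G → ℂ) (x : G) : ℂ :=
  starRingEnd ℂ (f x⁻¹)

namespace WeightedLp

instance {G : Type*} [MeasurableSpace G] (μ : Measure G) (ω : G → ℝ) (p : ℝ) [Fact (1 < p)] :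
    NormedAddCommGroup (WeightedLp μ ω p) :=
  haveI := fact_one_le_ofReal p
  inferInstanceAs (NormedAddCommGroup (Lp ℂ (ENNReal.ofReal p) (weightedMeasure μ ω p)))

instance {G : Type*} [MeasurableSpace G] (μ : Measure G) (ω : G → ℝ) (p : ℝ) [Fact (1 < p)] :
    NormedSpace ℂ (WeightedLp μ ω p) :=
  haveI := fact_one_le_ofReal p
  inferInstanceAs (NormedSpace ℂ (Lp ℂ (ENNReal.ofReal p) (weightedMeasure μ ω p)))

/-- A function representing an element of `L^p(G, ω)`. -/
def toFun {G : Type*} [MeasurableSpace G] {μ : Measure G} {ω : G → ℝ} {p : ℝ}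
    (f : WeightedLp μ ω p) : G → ℂ :=
  AEEqFun.cast (Subtype.val (show Lp ℂ (ENNReal.ofReal p) (weightedMeasure μ ω p) from f))

open Classical in
/-- The class in `L^p(G, ω)` of a function `φ` that lies in this space (and `0` otherwise). -/
def ofFun {G : Type*} [MeasurableSpace G] (μ : Measure G) (ω : G → ℝ) (p : ℝ) (φ : G → ℂ) :
    WeightedLp μ ω p :=
  if h : MemLp φ (ENNReal.ofReal p) (weightedMeasure μ ω p) then h.toLp φ
  else (0 : Lp ℂ (ENNReal.ofReal p) (weightedMeasure μ ω p))

/-- The product of `L^p(G, ω)` is convolution. -/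
instance {G : Type*} [Group G] [MeasurableSpace G] (μ : Measure G) (ω : G → ℝ) (p : ℝ) :
    Mul (WeightedLp μ ω p) :=
  ⟨fun f g => ofFun μ ω p (groupConvolution μ f.toFun g.toFun)⟩

/-- The involution of `L^p(G, ω)`. -/
instance {G : Type*} [Group G] [MeasurableSpace G] (μ : Measure G) (ω : G → ℝ) (p : ℝ) :
    Star (WeightedLp μ ω p) :=
  ⟨fun f => ofFun μ ω p (groupInvolution f.toFun)⟩

end WeightedLp

/-! ## Symmetric Banach `*`-algebras -/

/-- `A`, with its norm, product and involution, is a (not necessarily unital) complex Banach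
`*`-algebra with isometric involution. -/
structure IsBanachStarAlgebra (A : Type*) [NormedAddCommGroup A] [NormedSpace ℂ A] [Mul A]
    [Star A] : Prop where
  complete : CompleteSpace A
  mul_assoc : ∀ a b c : A, a * b * c = a * (b * c)
  add_mul : ∀ a b c : A, (a + b) * c = a * c + b * c
  mul_add : ∀ a b c : A, a * (b + c) = a * b + a * c
  smul_mul : ∀ (z : ℂ) (a b : A), (z • a) * b = z • (a * b)
  mul_smul : ∀ (z : ℂ) (a b : A), a * (z • b) = z • (a * b)
  norm_mul_le : ∀ a b : A, ‖a * b‖ ≤ ‖a‖ * ‖b‖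
  star_star : ∀ a : A, star (star a) = a
  star_add : ∀ a b : A, star (a + b) = star a + star b
  star_smul : ∀ (z : ℂ) (a : A), star (z • a) = starRingEnd ℂ z • star a
  star_mul : ∀ a b : A, star (a * b) = star b * star a
  norm_star : ∀ a : A, ‖star a‖ = ‖a‖

namespace IsBanachStarAlgebra

/-- The ring underlying a Banach `*`-algebra. -/
abbrev toNonUnitalRing {A : Type*} [NormedAddCommGroup A] [NormedSpace ℂ A] [Mul A] [Star A]
    (h : IsBanachStarAlgebra A) : NonUnitalRing A :=
  { (inferInstance : AddCommGroup A), (inferInstance : Mul A) with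
    left_distrib := h.mul_add
    right_distrib := h.add_mul
    zero_mul := fun a => by simpa using h.smul_mul 0 0 a
    mul_zero := fun a => by simpa using h.mul_smul 0 a 0
    mul_assoc := h.mul_assoc }

/-- The Banach `*`-algebra `A` is symmetric: the spectrum of `a^* a` lies in `[0, ∞)` for every
`a`. The quasispectrum is the spectrum in the unitization of `A`; if `A` has a unit, it is the
spectrum in `A` together with `0`. -/
def IsSymmetric {A : Type*} [NormedAddCommGroup A] [NormedSpace ℂ A] [Mul A] [Star A]
    (h : IsBanachStarAlgebra A) : Prop :=
  letI := h.toNonUnitalRing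
  ∀ a : A, quasispectrum ℂ (star a * a) ⊆ {z : ℂ | ∃ r : ℝ, 0 ≤ r ∧ z = r}

end IsBanachStarAlgebra

end

/-!
The product on `L^p(G, ω)` is controlled by Hölder's inequality: writing `f g = (fω)(gω)·ω⁻¹ω⁻¹`
under the convolution integral and using `ω^{-q} * ω^{-q} ≤ ω^{-q}` gives
`(|f| * |g|)^p ω^p ≤ (|f|ω)^p * (|g|ω)^p` pointwise (`lintegral_enorm_mul_rpow_le`), and Tonelli's
theorem yields submultiplicativity of the norm. Since `G` need not be second countable,
`(x, y) ↦ g (y⁻¹ x)` may fail to be measurable for the product `σ`-algebra; this is repaired by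
passing to almost everywhere limits of continuous functions with compact support
(`exists_ae_eq_stronglyMeasurable_inv_mul`). Condition (S) makes `ω` bounded on compact sets, so
such functions are dense in `L^p(G, ω)`, and associativity follows from Fubini's theorem for them.

For symmetry, the algebra is commutative, so by Gelfand theory for its unitization it suffices that
every continuous multiplicative functional `φ` satisfies `φ (f^*) = conj (φ f)`
(`IsBanachStarAlgebra.isSymmetric_of_map_star`), and by density that `φ h` is real for Hermitian
`h` continuous with compact support. Put `g_m = (h + it)^m * h`. Convolution by `h` is a symmetric
operator on `L²` of norm at most `c = ‖h‖₁`, whence `‖g_m‖₂² ≤ (c² + t²)^m ‖h‖₂²`. The function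
`g_m * h` is supported in a set `K^{m+2}`, on which `ω` is subexponential by (S) and whose measure
grows polynomially, and it is uniformly bounded by a constant times `(c² + t²)^{m/2}`. Its norm in
`L^p(G, ω)` is therefore a subexponential factor times `(c² + t²)^{m/2}`, while
`φ (g_m * h) = (φ h + it)^m (φ h)²`. Taking `m`-th roots gives `|φ h + it|² ≤ c² + t²` for all real
`t` when `φ h ≠ 0` (`WeightedLp.norm_map_add_le`), which forces `φ h` to be real.
-/

/-! ### Generating neighbourhoods and condition (S) -/

theorem IsCompact.set_pow {G : Type*} [TopologicalSpace G] [Group G] [IsTopologicalGroup G]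
    {K : Set G} (hK : IsCompact K) (n : ℕ) : IsCompact (K ^ n) := by
  induction n with
  | zero => simp
  | succ n ih => rw [pow_succ]; exact ih.mul hK

namespace IsGeneratingNhd

variable {G : Type*} [TopologicalSpace G] [Group G] {U : Set G}

theorem one_mem (hU : IsGeneratingNhd U) : (1 : G) ∈ U := mem_of_mem_nhds hU.mem_nhds

theorem pow_mono (hU : IsGeneratingNhd U) : Monotone fun n : ℕ => U ^ n :=
  fun _ _ h => Set.pow_subset_pow_right hU.one_mem h

theorem one_mem_pow (hU : IsGeneratingNhd U) (n : ℕ) : (1 : G) ∈ U ^ n :=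
  hU.pow_mono (Nat.zero_le n) (by simp)

theorem exists_mem_pow (hU : IsGeneratingNhd U) (x : G) : ∃ n : ℕ, 1 ≤ n ∧ x ∈ U ^ n := by
  have hx : x ∈ ⋃ n : ℕ, U ^ n := hU.generates ▸ Set.mem_univ x
  obtain ⟨n, hn⟩ := Set.mem_iUnion.1 hx
  exact ⟨n + 1, by omega, hU.pow_mono n.le_succ hn⟩

theorem mem_pow_wordLength (hU : IsGeneratingNhd U) (x : G) : x ∈ U ^ wordLength U x :=
  (Nat.sInf_mem (hU.exists_mem_pow x)).2

/-- The powers of a generating neighbourhood absorb every compact set. -/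
theorem exists_subset_pow [IsTopologicalGroup G] (hU : IsGeneratingNhd U) {K : Set G}
    (hK : IsCompact K) : ∃ n : ℕ, K ⊆ U ^ n := by
  obtain ⟨n, hn⟩ := hK.elim_directed_cover (fun n : ℕ => interior (U ^ n))
    (fun _ => isOpen_interior)
    (fun x _ => by
      obtain ⟨n, -, hn⟩ := hU.exists_mem_pow x
      refine Set.mem_iUnion.2 ⟨n + 1, mem_interior_iff_mem_nhds.2 ?_⟩
      have hxU : x • U ∈ 𝓝 x := by
        simpa using smul_mem_nhds_smul x hU.mem_nhds
      refine mem_of_superset hxU ?_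
      rw [pow_succ]
      rintro _ ⟨y, hy, rfl⟩
      exact Set.mul_mem_mul hn hy)
    (Monotone.directed_le fun m n h => interior_mono (hU.pow_mono h))
  exact ⟨n, hn.trans interior_subset⟩

theorem sigmaCompactSpace [IsTopologicalGroup G] (hU : IsGeneratingNhd U) :
    SigmaCompactSpace G := by
  refine ⟨⟨fun n => closure U ^ n, fun n => hU.relativelyCompact.set_pow n, ?_⟩⟩
  refine Set.eq_univ_of_subset (Set.iUnion_mono fun n => ?_) hU.generates
  exact Set.pow_subset_pow_left subset_closure

end IsGeneratingNhd

theorem wordLength_le {G : Type*} [Group G] {U : Set G} {x : G} {n : ℕ} (hn : 1 ≤ n)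
    (hx : x ∈ U ^ n) : wordLength U x ≤ n :=
  Nat.sInf_le ⟨hn, hx⟩

namespace ConditionS

variable {G : Type*} [TopologicalSpace G] [Group G] {ω : G → ℝ}

/-- Condition (S) bounds `ω` subexponentially along the powers of a generating neighbourhood. -/
theorem exists_le_exp (hS : ConditionS ω) (h1 : ∀ x, 1 ≤ ω x) {U : Set G}
    (hU : IsGeneratingNhd U) {ε : ℝ} (hε : 0 < ε) :
    ∃ C : ℝ, 0 < C ∧ ∀ n : ℕ, ∀ x ∈ U ^ n, ω x ≤ C * Real.exp (ε * n) := by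
  have hlt : (1 : ℝ≥0∞) < ENNReal.ofReal (Real.exp ε) := by
    rw [ENNReal.one_lt_ofReal]; exact Real.one_lt_exp_iff.2 hε
  have hev := ((hS U hU).eventually (gt_mem_nhds hlt)).and (eventually_ge_atTop 1)
  obtain ⟨N, hN⟩ := eventually_atTop.1 hev
  have key : ∀ n, N ≤ n → ∀ x ∈ U ^ n, ω x ≤ Real.exp (ε * n) := by
    intro n hn x hx
    obtain ⟨hsup, hn1⟩ := hN n hn
    have hle : ENNReal.ofReal (ω x ^ (1 / (n : ℝ))) ≤ ENNReal.ofReal (Real.exp ε) :=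
      (le_iSup₂ (f := fun x (_ : x ∈ U ^ n) => ENNReal.ofReal (ω x ^ (1 / (n : ℝ)))) x hx).trans
        hsup.le
    rw [ENNReal.ofReal_le_ofReal_iff (Real.exp_pos _).le] at hle
    have h0 : 0 ≤ ω x := zero_le_one.trans (h1 x)
    have hn0 : (n : ℝ) ≠ 0 := by positivity
    calc ω x = (ω x ^ (1 / (n : ℝ))) ^ n := by
          rw [← Real.rpow_natCast, ← Real.rpow_mul h0, one_div_mul_cancel hn0, Real.rpow_one]
      _ ≤ Real.exp ε ^ n := pow_le_pow_left₀ (Real.rpow_nonneg h0 _) hle n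
      _ = Real.exp (ε * n) := by rw [← Real.exp_nat_mul, mul_comm]
  refine ⟨Real.exp (ε * N), Real.exp_pos _, fun n x hx => ?_⟩
  rcases le_total N n with h | h
  · refine (key n h x hx).trans (le_mul_of_one_le_left (Real.exp_pos _).le ?_)
    exact Real.one_le_exp (by positivity)
  · refine (key N le_rfl x (hU.pow_mono h hx)).trans
      (le_mul_of_one_le_right (Real.exp_pos _).le ?_)
    exact Real.one_le_exp (by positivity)

/-- Under condition (S) the weight is bounded on compact sets. -/
theorem exists_le_of_isCompact [IsTopologicalGroup G] (hS : ConditionS ω) (h1 : ∀ x, 1 ≤ ω x)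
    {U : Set G} (hU : IsGeneratingNhd U) {K : Set G} (hK : IsCompact K) :
    ∃ M : ℝ, ∀ x ∈ K, ω x ≤ M := by
  obtain ⟨n, hn⟩ := hU.exists_subset_pow hK
  obtain ⟨C, -, h⟩ := hS.exists_le_exp h1 hU one_pos
  exact ⟨C * Real.exp (1 * n), fun x hx => h n x (hn hx)⟩

end ConditionS

/-- Condition (S) can be tested on one generating neighbourhood `U`: any other one lies in some
power `U ^ k`, so passing to it changes word lengths by at most the factor `k`. -/
theorem conditionS_iff_wordLength {G : Type*} [TopologicalSpace G] [Group G]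
    [IsTopologicalGroup G] {ω : G → ℝ} (h1 : ∀ x, 1 ≤ ω x) {U : Set G}
    (hU : IsGeneratingNhd U) :
    ConditionS ω ↔
      ∀ ε : ℝ, 0 < ε → ∃ C : ℝ, ∀ x : G, ω x ≤ C * Real.exp (ε * wordLength U x) := by
  constructor
  · intro hS ε hε
    obtain ⟨C, -, hC⟩ := hS.exists_le_exp h1 hU hε
    exact ⟨C, fun x => hC _ x (hU.mem_pow_wordLength x)⟩
  · intro h V hV
    obtain ⟨k, hk⟩ := hU.exists_subset_pow hV.relativelyCompact
    have hlow : ∀ n : ℕ, 1 ≤ ⨆ x ∈ V ^ n, ENNReal.ofReal (ω x ^ (1 / (n : ℝ))) := by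
      intro n
      refine le_trans ?_ (le_iSup₂ (f := fun x (_ : x ∈ V ^ n) =>
        ENNReal.ofReal (ω x ^ (1 / (n : ℝ)))) 1 (hV.one_mem_pow n))
      rw [ENNReal.one_le_ofReal]
      exact Real.one_le_rpow (h1 1) (by positivity)
    refine tendsto_order.2 ⟨fun a ha => Eventually.of_forall fun n => ha.trans_le (hlow n), ?_⟩
    intro a ha
    -- It suffices to treat `a = e^δ`; the constant `C` disappears after taking `n`-th roots.
    obtain ⟨δ, hδ, hδa⟩ : ∃ δ : ℝ, 0 < δ ∧ ENNReal.ofReal (Real.exp δ) < a := by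
      have hc : Tendsto (fun δ : ℝ => ENNReal.ofReal (Real.exp δ)) (𝓝[>] 0) (𝓝 1) := by
        have : Continuous fun δ : ℝ => ENNReal.ofReal (Real.exp δ) :=
          ENNReal.continuous_ofReal.comp Real.continuous_exp
        simpa using (this.tendsto 0).mono_left nhdsWithin_le_nhds
      obtain ⟨δ, h1, h2⟩ := ((hc.eventually (gt_mem_nhds ha)).and self_mem_nhdsWithin).exists
      exact ⟨δ, h2, h1⟩
    set ε : ℝ := δ / (2 * (k + 1)) with hεdef
    have hε : 0 < ε := by positivity
    obtain ⟨C, hC⟩ := h ε hε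
    have hC0 : 0 < C := by
      have := (zero_lt_one.trans_le (h1 1)).trans_le (hC 1)
      exact pos_of_mul_pos_left this (Real.exp_pos _).le
    have hev : ∀ᶠ n : ℕ in atTop, Real.log C / (δ / 2) ≤ n :=
      tendsto_natCast_atTop_atTop.eventually (eventually_ge_atTop _)
    filter_upwards [hev, eventually_ge_atTop 1] with n hn hn1
    refine lt_of_le_of_lt (iSup₂_le fun x hx => ENNReal.ofReal_le_ofReal ?_) hδa
    have hx' : x ∈ U ^ ((k + 1) * n) := by
      have h1 : x ∈ (U ^ k) ^ n := Set.pow_subset_pow_left (subset_closure.trans hk) hx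
      rw [← pow_mul] at h1
      exact hU.pow_mono (Nat.mul_le_mul_right n k.le_succ) h1
    have hlen : (wordLength U x : ℝ) ≤ (k + 1) * n := by
      exact_mod_cast wordLength_le (Nat.mul_pos k.succ_pos hn1) hx'
    have hn0 : (0 : ℝ) < n := by exact_mod_cast hn1
    have hωx : ω x ≤ Real.exp (δ * n) := by
      refine (hC x).trans ?_
      rw [← Real.exp_log hC0, ← Real.exp_add]
      refine Real.exp_le_exp.2 ?_
      have h2 : Real.log C ≤ n * (δ / 2) := (div_le_iff₀ (by positivity)).1 hn
      have h3 : ε * wordLength U x ≤ ε * ((k + 1) * n) := mul_le_mul_of_nonneg_left hlen hε.le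
      have h4 : ε * ((k + 1) * n) = δ / 2 * n := by rw [hεdef]; field_simp
      linarith
    calc ω x ^ (1 / (n : ℝ)) ≤ Real.exp (δ * n) ^ (1 / (n : ℝ)) :=
          Real.rpow_le_rpow (zero_le_one.trans (h1 x)) hωx (by positivity)
      _ = Real.exp δ := by
          rw [← Real.exp_mul]; congr 1; field_simp

/-! ### Measurability and Tonelli's theorem for convolutions -/

section Measurability

variable {G : Type*} [CommGroup G] [TopologicalSpace G] [IsTopologicalGroup G]
  [MeasurableSpace G] [BorelSpace G] {μ : Measure G}

theorem measurePreserving_inv_mul [μ.IsHaarMeasure] [μ.IsInvInvariant] (x : G) :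
    MeasurePreserving (fun y : G => y⁻¹ * x) μ μ := by
  simpa [inv_mul_eq_div] using Measure.measurePreserving_div_left μ x

variable [T2Space G] [LocallyCompactSpace G]

/-- The function `(x, y) ↦ f (y⁻¹ x)` is measurable for the product `σ`-algebra, which may be
strictly smaller than the Borel `σ`-algebra of `G × G`. -/
theorem stronglyMeasurable_inv_mul_of_hasCompactSupport [SigmaCompactSpace G] {f : G → ℂ}
    (hf : Continuous f) (hfc : HasCompactSupport f) :
    StronglyMeasurable fun z : G × G => f (z.2⁻¹ * z.1) := by
  have hθ : ∀ n : ℕ, ∃ θ : C(G, ℝ), EqOn θ 1 (compactCovering G n) ∧ HasCompactSupport θ := by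
    intro n
    obtain ⟨θ, h1, -, h2, -⟩ := exists_continuous_one_zero_of_isCompact
      (isCompact_compactCovering G n) isClosed_empty (disjoint_empty _)
    exact ⟨θ, h1, h2⟩
  choose θ hθ1 hθc using hθ
  refine stronglyMeasurable_of_tendsto atTop
    (f := fun n (z : G × G) => (θ n z.2 : ℂ) * f (z.2⁻¹ * z.1)) (fun n => ?_) ?_
  · refine HasCompactSupport.stronglyMeasurable_of_prod (by fun_prop) ?_
    refine HasCompactSupport.intro
      (((hθc n).isCompact.prod hfc.isCompact).image (f := fun z : G × G => (z.1 * z.2, z.1))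
        (by fun_prop)) ?_
    rintro ⟨x, y⟩ hxy
    by_contra hne
    obtain ⟨h1, h2⟩ := mul_ne_zero_iff.1 hne
    refine hxy ⟨(y, y⁻¹ * x), ⟨subset_tsupport _ ?_, subset_tsupport _ h2⟩, by simp⟩
    simpa using h1
  · refine tendsto_pi_nhds.2 fun z => tendsto_const_nhds.congr' ?_
    obtain ⟨n, hn⟩ : ∃ n, z.2 ∈ compactCovering G n :=
      Set.mem_iUnion.1 (iUnion_compactCovering G ▸ Set.mem_univ z.2)
    filter_upwards [eventually_ge_atTop n] with m hm
    simp [hθ1 m (compactCovering_subset G hm hn)]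

/-- Every `L^r` function agrees almost everywhere with a function `f'` for which
`(x, y) ↦ f' (y⁻¹ x)` is measurable for the product `σ`-algebra, namely a limit of a sequence of
continuous functions with compact support. This replaces the measurability of the multiplication
`G × G → G`, which may fail since `G` need not be second countable. -/
theorem exists_ae_eq_stronglyMeasurable_inv_mul [SigmaCompactSpace G] [μ.IsHaarMeasure]
    [μ.Regular] {f : G → ℂ} {r : ℝ≥0∞} (h0 : r ≠ 0) (hr : r ≠ ∞) (hf : MemLp f r μ) :
    ∃ f' : G → ℂ, f =ᵐ[μ] f' ∧ StronglyMeasurable f' ∧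
      StronglyMeasurable fun z : G × G => f' (z.2⁻¹ * z.1) := by
  have hg : ∀ n : ℕ, ∃ g : G → ℂ, HasCompactSupport g ∧ eLpNorm (f - g) r μ ≤ (n : ℝ≥0∞)⁻¹ ∧
      Continuous g ∧ MemLp g r μ := fun n =>
    hf.exists_hasCompactSupport_eLpNorm_sub_le hr (by simp)
  choose g hgc hgn hgcont hgm using hg
  have htend : Tendsto (fun n => eLpNorm (g n - f) r μ) atTop (𝓝 0) := by
    refine tendsto_of_tendsto_of_tendsto_of_le_of_le tendsto_const_nhds
      ENNReal.tendsto_inv_nat_nhds_zero (fun _ => zero_le) fun n => ?_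
    simpa [eLpNorm_sub_comm] using hgn n
  obtain ⟨ns, -, hns⟩ := (tendstoInMeasure_of_tendsto_eLpNorm h0 (fun n => (hgm n).1) hf.1
    htend).exists_seq_tendsto_ae
  refine ⟨fun x => limUnder atTop fun i => g (ns i) x, ?_, ?_, ?_⟩
  · filter_upwards [hns] with x hx using hx.limUnder_eq.symm
  · exact StronglyMeasurable.limUnder fun i =>
      (hgcont _).stronglyMeasurable_of_hasCompactSupport (hgc _)
  · exact StronglyMeasurable.limUnder fun i =>
      stronglyMeasurable_inv_mul_of_hasCompactSupport (hgcont (ns i)) (hgc (ns i))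

theorem lintegral_lintegral_inv_mul [SigmaCompactSpace G] [μ.IsHaarMeasure] [μ.Regular]
    {F H : G → ℝ≥0∞} (hF : Measurable F) (hH : Measurable H) (hHi : ∫⁻ x, H x ∂μ ≠ ∞) :
    ∫⁻ x, ∫⁻ y, F y * H (y⁻¹ * x) ∂μ ∂μ = (∫⁻ x, F x ∂μ) * ∫⁻ x, H x ∂μ := by
  have hfin : ∀ᵐ x ∂μ, H x < ∞ := ae_lt_top hH hHi
  have heq : ∀ᵐ x ∂μ, H x = ‖((H x).toReal : ℂ)‖ₑ := by
    filter_upwards [hfin] with x hx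
    rw [← ofReal_norm, Complex.norm_real, Real.norm_of_nonneg ENNReal.toReal_nonneg,
      ENNReal.ofReal_toReal hx.ne]
  have hmem : MemLp (fun x => ((H x).toReal : ℂ)) 1 μ := by
    refine ⟨(Complex.measurable_ofReal.comp hH.ennreal_toReal).aestronglyMeasurable, ?_⟩
    rw [eLpNorm_one_eq_lintegral_enorm, ← lintegral_congr_ae heq]
    exact hHi.lt_top
  obtain ⟨h, hh, hh1, hh2⟩ :=
    exists_ae_eq_stronglyMeasurable_inv_mul one_ne_zero ENNReal.one_ne_top hmem
  have hHh : H =ᵐ[μ] fun x => ‖h x‖ₑ := by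
    filter_upwards [heq, hh] with x h1 h2
    rw [h1, h2]
  have hmeas : Measurable fun z : G × G => F z.2 * ‖h (z.2⁻¹ * z.1)‖ₑ :=
    (hF.comp measurable_snd).mul hh2.enorm
  calc ∫⁻ x, ∫⁻ y, F y * H (y⁻¹ * x) ∂μ ∂μ
      = ∫⁻ x, ∫⁻ y, F y * ‖h (y⁻¹ * x)‖ₑ ∂μ ∂μ := by
        refine lintegral_congr fun x => lintegral_congr_ae ?_
        filter_upwards [(measurePreserving_inv_mul x).quasiMeasurePreserving.ae_eq_comp hHh]
          with y hy
        exact congrArg (F y * ·) hy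
    _ = ∫⁻ y, ∫⁻ x, F y * ‖h (y⁻¹ * x)‖ₑ ∂μ ∂μ :=
        lintegral_lintegral_swap hmeas.aemeasurable
    _ = ∫⁻ y, F y * ∫⁻ x, H x ∂μ ∂μ := by
        refine lintegral_congr fun y => ?_
        have hm : Measurable fun x => ‖h (y⁻¹ * x)‖ₑ := hh1.enorm.comp (measurable_const_mul _)
        rw [lintegral_const_mul _ hm,
          lintegral_mul_left_eq_self (fun x => ‖h x‖ₑ) y⁻¹, lintegral_congr_ae hHh]
    _ = (∫⁻ x, F x ∂μ) * ∫⁻ x, H x ∂μ := lintegral_mul_const _ hF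

end Measurability

/-! ### The weighted norm and convolution -/

section WeightedMeasure

variable {G : Type*} [MeasurableSpace G] {μ : Measure G} {ω : G → ℝ} {p : ℝ}

theorem weightedMeasure_absolutelyContinuous : weightedMeasure μ ω p ≪ μ :=
  withDensity_absolutelyContinuous _ _

theorem le_weightedMeasure (h1 : ∀ x, 1 ≤ ω x) (hp : 0 ≤ p) : μ ≤ weightedMeasure μ ω p := by
  have h : μ.withDensity 1 ≤ weightedMeasure μ ω p :=
    withDensity_mono (ae_of_all _ fun x => ENNReal.one_le_ofReal.2 (Real.one_le_rpow (h1 x) hp))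
  rwa [withDensity_one] at h

theorem ae_weightedMeasure (h1 : ∀ x, 1 ≤ ω x) (hp : 0 ≤ p) :
    ae (weightedMeasure μ ω p) = ae μ :=
  le_antisymm weightedMeasure_absolutelyContinuous.ae_le (ae_mono (le_weightedMeasure h1 hp))

theorem eLpNorm_weightedMeasure_rpow (hω : Measurable ω) (h1 : ∀ x, 1 ≤ ω x) (hp : 0 < p)
    (f : G → ℂ) :
    eLpNorm f (ENNReal.ofReal p) (weightedMeasure μ ω p) ^ p =
      ∫⁻ x, (‖f x‖ₑ * ENNReal.ofReal (ω x)) ^ p ∂μ := by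
  have hd : Measurable fun x => ENNReal.ofReal (ω x ^ p) := by fun_prop
  rw [eLpNorm_eq_lintegral_rpow_enorm_toReal (by simpa using hp) ENNReal.ofReal_ne_top,
    ENNReal.toReal_ofReal hp.le, ← ENNReal.rpow_mul, one_div_mul_cancel hp.ne', ENNReal.rpow_one,
    weightedMeasure, lintegral_withDensity_eq_lintegral_mul_non_measurable _ hd
      (ae_of_all _ fun _ => ENNReal.ofReal_lt_top)]
  refine lintegral_congr fun x => ?_
  rw [Pi.mul_apply, ENNReal.mul_rpow_of_nonneg _ _ hp.le, mul_comm,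
    ENNReal.ofReal_rpow_of_pos (zero_lt_one.trans_le (h1 x))]

end WeightedMeasure

section Convolution

variable {G : Type*} [CommGroup G] [MeasurableSpace G] {μ : Measure G} {ω : G → ℝ} {p q : ℝ}

/-- Hölder's inequality and `ω^{-q} * ω^{-q} ≤ ω^{-q}` bound `|f| * |g|` pointwise. -/
theorem lintegral_enorm_mul_rpow_le [MeasurableMul G] [MeasurableInv G]
    (hpq : p.HolderConjugate q) (hω : IsLPAlgWeight μ q ω)
    {f g : G → ℂ} (hf : Measurable f) (hg : Measurable g) (x : G) :
    ((∫⁻ y, ‖f y‖ₑ * ‖g (y⁻¹ * x)‖ₑ ∂μ) * ENNReal.ofReal (ω x)) ^ p ≤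
      ∫⁻ y, (‖f y‖ₑ * ENNReal.ofReal (ω y)) ^ p *
        (‖g (y⁻¹ * x)‖ₑ * ENNReal.ofReal (ω (y⁻¹ * x))) ^ p ∂μ := by
  set w : G → ℝ≥0∞ := fun x => ENNReal.ofReal (ω x) with hw
  have hpos : ∀ x, 0 < ω x := fun x => zero_lt_one.trans_le (hω.one_le x)
  have hw0 : ∀ x, w x ≠ 0 := fun x => (ENNReal.ofReal_pos.2 (hpos x)).ne'
  have hwt : ∀ x, w x ≠ ∞ := fun x => ENNReal.ofReal_ne_top
  have hwm : Measurable w := hω.measurable.ennreal_ofReal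
  have hshift : Measurable fun y : G => y⁻¹ * x := (measurable_mul_const x).comp measurable_inv
  set A : G → ℝ≥0∞ := fun y => (‖f y‖ₑ * w y) * (‖g (y⁻¹ * x)‖ₑ * w (y⁻¹ * x)) with hA
  set B : G → ℝ≥0∞ := fun y => (w y)⁻¹ * (w (y⁻¹ * x))⁻¹ with hB
  have hAm : Measurable A :=
    (hf.enorm.mul hwm).mul ((hg.comp hshift).enorm.mul (hwm.comp hshift))
  have hBm : Measurable B := hwm.inv.mul (hwm.comp hshift).inv
  have hAB : ∀ y, ‖f y‖ₑ * ‖g (y⁻¹ * x)‖ₑ = (A * B) y := by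
    intro y
    simp only [hA, hB, Pi.mul_apply]
    calc ‖f y‖ₑ * ‖g (y⁻¹ * x)‖ₑ
        = ‖f y‖ₑ * ‖g (y⁻¹ * x)‖ₑ * (w y * (w y)⁻¹) *
            (w (y⁻¹ * x) * (w (y⁻¹ * x))⁻¹) := by
          rw [ENNReal.mul_inv_cancel (hw0 _) (hwt _), ENNReal.mul_inv_cancel (hw0 _) (hwt _),
            mul_one, mul_one]
      _ = _ := by ring
  have hBq : (∫⁻ y, B y ^ q ∂μ) ^ (1 / q) ≤ (w x)⁻¹ := by
    have hwq : ∀ y, ENNReal.ofReal (ω y ^ (-q)) = (w y)⁻¹ ^ q := by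
      intro y
      rw [← ENNReal.ofReal_rpow_of_pos (hpos y), ENNReal.rpow_neg, ENNReal.inv_rpow]
    have h := hω.mlconvolution_le x
    rw [mlconvolution_def] at h
    simp only [hwq] at h
    calc (∫⁻ y, B y ^ q ∂μ) ^ (1 / q)
        = (∫⁻ y, (w y)⁻¹ ^ q * (w (y⁻¹ * x))⁻¹ ^ q ∂μ) ^ (1 / q) := by
          simp only [hB, ENNReal.mul_rpow_of_nonneg _ _ hpq.symm.nonneg]
      _ ≤ ((w x)⁻¹ ^ q) ^ (1 / q) := by
          exact ENNReal.rpow_le_rpow h (by have := hpq.symm.pos; positivity)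
      _ = (w x)⁻¹ := by
          rw [← ENNReal.rpow_mul, mul_one_div_cancel hpq.symm.ne_zero, ENNReal.rpow_one]
  have hHölder : ∫⁻ y, ‖f y‖ₑ * ‖g (y⁻¹ * x)‖ₑ ∂μ ≤ (∫⁻ y, A y ^ p ∂μ) ^ (1 / p) * (w x)⁻¹ := by
    rw [lintegral_congr hAB]
    exact (ENNReal.lintegral_mul_le_Lp_mul_Lq μ hpq hAm.aemeasurable hBm.aemeasurable).trans
      (mul_le_mul_right hBq _)
  calc ((∫⁻ y, ‖f y‖ₑ * ‖g (y⁻¹ * x)‖ₑ ∂μ) * w x) ^ p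
      ≤ ((∫⁻ y, A y ^ p ∂μ) ^ (1 / p) * (w x)⁻¹ * w x) ^ p :=
        ENNReal.rpow_le_rpow (mul_le_mul_left hHölder _) hpq.nonneg
    _ = ∫⁻ y, A y ^ p ∂μ := by
        rw [mul_assoc, ENNReal.inv_mul_cancel (hw0 x) (hwt x), mul_one, ← ENNReal.rpow_mul,
          one_div_mul_cancel hpq.ne_zero, ENNReal.rpow_one]
    _ = _ := lintegral_congr fun y => ENNReal.mul_rpow_of_nonneg _ _ hpq.nonneg

variable [TopologicalSpace G] [IsTopologicalGroup G] [T2Space G] [LocallyCompactSpace G]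
  [SigmaCompactSpace G] [BorelSpace G] [μ.IsHaarMeasure] [μ.Regular]

theorem lintegral_lintegral_enorm_mul_rpow_le (hpq : p.HolderConjugate q)
    (hω : IsLPAlgWeight μ q ω) {f g : G → ℂ} (hf : Measurable f) (hg : Measurable g)
    (hgp : MemLp g (ENNReal.ofReal p) (weightedMeasure μ ω p)) :
    ∫⁻ x, ((∫⁻ y, ‖f y‖ₑ * ‖g (y⁻¹ * x)‖ₑ ∂μ) * ENNReal.ofReal (ω x)) ^ p ∂μ ≤
      (eLpNorm f (ENNReal.ofReal p) (weightedMeasure μ ω p) *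
        eLpNorm g (ENNReal.ofReal p) (weightedMeasure μ ω p)) ^ p := by
  have hw : Measurable fun x => ENNReal.ofReal (ω x) := hω.measurable.ennreal_ofReal
  refine (lintegral_mono fun x => lintegral_enorm_mul_rpow_le hpq hω hf hg x).trans_eq ?_
  rw [lintegral_lintegral_inv_mul (F := fun y => (‖f y‖ₑ * ENNReal.ofReal (ω y)) ^ p)
    (H := fun y => (‖g y‖ₑ * ENNReal.ofReal (ω y)) ^ p) ((hf.enorm.mul hw).pow_const p)
    ((hg.enorm.mul hw).pow_const p) ?_, ENNReal.mul_rpow_of_nonneg _ _ hpq.nonneg,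
    eLpNorm_weightedMeasure_rpow hω.measurable hω.one_le hpq.pos,
    eLpNorm_weightedMeasure_rpow hω.measurable hω.one_le hpq.pos]
  rw [← eLpNorm_weightedMeasure_rpow hω.measurable hω.one_le hpq.pos]
  exact ENNReal.rpow_ne_top_of_nonneg hpq.nonneg hgp.2.ne

theorem exists_ae_eq_inv_mul_of_memLp_weightedMeasure (hp : 1 ≤ p) (h1 : ∀ x, 1 ≤ ω x)
    {g : G → ℂ} (hgp : MemLp g (ENNReal.ofReal p) (weightedMeasure μ ω p)) :
    ∃ g' : G → ℂ, g =ᵐ[μ] g' ∧ StronglyMeasurable g' ∧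
      StronglyMeasurable fun z : G × G => g' (z.2⁻¹ * z.1) :=
  exists_ae_eq_stronglyMeasurable_inv_mul (by simpa using zero_lt_one.trans_le hp)
    ENNReal.ofReal_ne_top (hgp.mono_measure (le_weightedMeasure h1 (zero_le_one.trans hp)))

theorem ae_integrable_mul_inv_mul (hpq : p.HolderConjugate q)
    (hω : IsLPAlgWeight μ q ω) {f g : G → ℂ} (hf : Measurable f) (hg : Measurable g)
    (hfp : MemLp f (ENNReal.ofReal p) (weightedMeasure μ ω p))
    (hgp : MemLp g (ENNReal.ofReal p) (weightedMeasure μ ω p)) :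
    ∀ᵐ x ∂μ, Integrable (fun y => f y * g (y⁻¹ * x)) μ := by
  have hle := lintegral_lintegral_enorm_mul_rpow_le hpq hω hf hg hgp
  obtain ⟨g', hgg', -, hg'⟩ :=
    exists_ae_eq_inv_mul_of_memLp_weightedMeasure hpq.lt.le hω.one_le hgp
  have heq : ∀ x, ∫⁻ y, ‖f y‖ₑ * ‖g (y⁻¹ * x)‖ₑ ∂μ = ∫⁻ y, ‖f y‖ₑ * ‖g' (y⁻¹ * x)‖ₑ ∂μ := by
    intro x
    refine lintegral_congr_ae ?_
    filter_upwards [(measurePreserving_inv_mul x).quasiMeasurePreserving.ae_eq_comp hgg']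
      with y hy
    exact congrArg (fun z => ‖f y‖ₑ * ‖z‖ₑ) hy
  simp only [heq] at hle
  have hm : Measurable fun x => ∫⁻ y, ‖f y‖ₑ * ‖g' (y⁻¹ * x)‖ₑ ∂μ :=
    Measurable.lintegral_prod_right' (ν := μ)
      (f := fun z : G × G => ‖f z.2‖ₑ * ‖g' (z.2⁻¹ * z.1)‖ₑ)
      ((hf.enorm.comp measurable_snd).mul hg'.enorm)
  have hfin := ae_lt_top ((hm.mul hω.measurable.ennreal_ofReal).pow_const p)
    (hle.trans_lt (ENNReal.rpow_lt_top_of_nonneg hpq.nonneg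
      (ENNReal.mul_lt_top hfp.2 hgp.2).ne)).ne
  filter_upwards [hfin] with x hx
  have hgx : Measurable fun y => g (y⁻¹ * x) :=
    hg.comp ((measurable_mul_const x).comp measurable_inv)
  refine ⟨(hf.mul hgx).aestronglyMeasurable, ?_⟩
  have hωx : ENNReal.ofReal (ω x) ≠ 0 :=
    (ENNReal.ofReal_pos.2 (zero_lt_one.trans_le (hω.one_le x))).ne'
  rw [HasFiniteIntegral]
  simp only [enorm_mul, heq x]
  exact ENNReal.lt_top_of_mul_ne_top_left ((ENNReal.rpow_lt_top_iff_of_pos hpq.pos).1 hx).ne hωx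

theorem stronglyMeasurable_groupConvolution (hp : 1 ≤ p) (h1 : ∀ x, 1 ≤ ω x)
    {f g : G → ℂ} (hf : StronglyMeasurable f)
    (hgp : MemLp g (ENNReal.ofReal p) (weightedMeasure μ ω p)) :
    StronglyMeasurable (groupConvolution μ f g) := by
  obtain ⟨g', hg, -, hg'⟩ := exists_ae_eq_inv_mul_of_memLp_weightedMeasure hp h1 hgp
  have heq : groupConvolution μ f g = groupConvolution μ f g' := by
    funext x
    refine integral_congr_ae ?_
    filter_upwards [(measurePreserving_inv_mul x).quasiMeasurePreserving.ae_eq_comp hg] with y hy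
    exact congrArg (f y * ·) hy
  rw [heq]
  exact StronglyMeasurable.integral_prod_right (ν := μ) (f := fun x y => f y * g' (y⁻¹ * x))
    ((hf.comp_measurable measurable_snd).mul hg')

/-- The norm of `L^p(G, ω)` is submultiplicative for convolution. -/
theorem eLpNorm_groupConvolution_le (hpq : p.HolderConjugate q)
    (hω : IsLPAlgWeight μ q ω) {f g : G → ℂ} (hf : Measurable f) (hg : Measurable g)
    (hgp : MemLp g (ENNReal.ofReal p) (weightedMeasure μ ω p)) :
    eLpNorm (groupConvolution μ f g) (ENNReal.ofReal p) (weightedMeasure μ ω p) ≤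
      eLpNorm f (ENNReal.ofReal p) (weightedMeasure μ ω p) *
        eLpNorm g (ENNReal.ofReal p) (weightedMeasure μ ω p) := by
  rw [← ENNReal.rpow_le_rpow_iff hpq.pos,
    eLpNorm_weightedMeasure_rpow hω.measurable hω.one_le hpq.pos]
  refine le_trans (lintegral_mono fun x => ?_)
    (lintegral_lintegral_enorm_mul_rpow_le hpq hω hf hg hgp)
  refine ENNReal.rpow_le_rpow (mul_le_mul_left ?_ _) hpq.nonneg
  refine (enorm_integral_le_lintegral_enorm _).trans_eq ?_
  simp only [enorm_mul]

theorem MemLp.groupConvolution (hpq : p.HolderConjugate q)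
    (hω : IsLPAlgWeight μ q ω) {f g : G → ℂ} (hf : Measurable f) (hg : Measurable g)
    (hfp : MemLp f (ENNReal.ofReal p) (weightedMeasure μ ω p))
    (hgp : MemLp g (ENNReal.ofReal p) (weightedMeasure μ ω p)) :
    MemLp (groupConvolution μ f g) (ENNReal.ofReal p) (weightedMeasure μ ω p) :=
  ⟨(stronglyMeasurable_groupConvolution hpq.lt.le hω.one_le hf.stronglyMeasurable
    hgp).aestronglyMeasurable,
    (eLpNorm_groupConvolution_le hpq hω hf hg hgp).trans_lt (ENNReal.mul_lt_top hfp.2 hgp.2)⟩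

end Convolution

/-! ### Operations on the weighted space -/

namespace WeightedLp

section Basic

variable {G : Type*} [MeasurableSpace G] {μ : Measure G} {ω : G → ℝ} {p : ℝ}

theorem stronglyMeasurable_toFun (f : WeightedLp μ ω p) : StronglyMeasurable f.toFun :=
  AEEqFun.stronglyMeasurable _

theorem measurable_toFun (f : WeightedLp μ ω p) : Measurable f.toFun :=
  f.stronglyMeasurable_toFun.measurable

theorem memLp_toFun (f : WeightedLp μ ω p) :
    MemLp f.toFun (ENNReal.ofReal p) (weightedMeasure μ ω p) :=
  Lp.memLp (show Lp ℂ (ENNReal.ofReal p) (weightedMeasure μ ω p) from f)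

/-- The primed lemmas of this part hold almost everywhere for the weighted measure, which has the
same null sets as `μ` when `ω ≥ 1`. -/
theorem toFun_ofFun' {φ : G → ℂ} (h : MemLp φ (ENNReal.ofReal p) (weightedMeasure μ ω p)) :
    (ofFun μ ω p φ).toFun =ᵐ[weightedMeasure μ ω p] φ := by
  have h' : ofFun μ ω p φ = (h.toLp φ : Lp ℂ (ENNReal.ofReal p) (weightedMeasure μ ω p)) :=
    dif_pos h
  rw [h']
  exact h.coeFn_toLp

theorem ext' {f g : WeightedLp μ ω p} (h : f.toFun =ᵐ[weightedMeasure μ ω p] g.toFun) : f = g :=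
  Lp.ext h

theorem toFun_ofFun (h1 : ∀ x, 1 ≤ ω x) (hp : 0 ≤ p) {φ : G → ℂ}
    (h : MemLp φ (ENNReal.ofReal p) (weightedMeasure μ ω p)) :
    (ofFun μ ω p φ).toFun =ᵐ[μ] φ := by
  rw [EventuallyEq, ← ae_weightedMeasure h1 hp]
  exact toFun_ofFun' h

theorem ext (h1 : ∀ x, 1 ≤ ω x) (hp : 0 ≤ p) {f g : WeightedLp μ ω p}
    (h : f.toFun =ᵐ[μ] g.toFun) : f = g := by
  rw [EventuallyEq, ← ae_weightedMeasure h1 hp] at h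
  exact ext' h

theorem ofFun_toFun (f : WeightedLp μ ω p) : ofFun μ ω p f.toFun = f :=
  ext' (toFun_ofFun' f.memLp_toFun)

variable [Fact (1 < p)]

theorem norm_def (f : WeightedLp μ ω p) :
    ‖f‖ = (eLpNorm f.toFun (ENNReal.ofReal p) (weightedMeasure μ ω p)).toReal :=
  rfl

theorem norm_ofFun {φ : G → ℂ} (h : MemLp φ (ENNReal.ofReal p) (weightedMeasure μ ω p)) :
    ‖ofFun μ ω p φ‖ = (eLpNorm φ (ENNReal.ofReal p) (weightedMeasure μ ω p)).toReal := by
  rw [norm_def, eLpNorm_congr_ae (toFun_ofFun' h)]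

theorem toFun_add' (f g : WeightedLp μ ω p) :
    (f + g).toFun =ᵐ[weightedMeasure μ ω p] f.toFun + g.toFun :=
  Lp.coeFn_add (show Lp ℂ (ENNReal.ofReal p) (weightedMeasure μ ω p) from f) g

theorem toFun_smul' (c : ℂ) (f : WeightedLp μ ω p) :
    (c • f).toFun =ᵐ[weightedMeasure μ ω p] c • f.toFun :=
  haveI := fact_one_le_ofReal p
  Lp.coeFn_smul c (show Lp ℂ (ENNReal.ofReal p) (weightedMeasure μ ω p) from f)

theorem toFun_add (h1 : ∀ x, 1 ≤ ω x) (hp : 0 ≤ p) (f g : WeightedLp μ ω p) :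
    (f + g).toFun =ᵐ[μ] f.toFun + g.toFun := by
  rw [EventuallyEq, ← ae_weightedMeasure h1 hp]
  exact toFun_add' f g

theorem toFun_smul (h1 : ∀ x, 1 ≤ ω x) (hp : 0 ≤ p) (c : ℂ) (f : WeightedLp μ ω p) :
    (c • f).toFun =ᵐ[μ] c • f.toFun := by
  rw [EventuallyEq, ← ae_weightedMeasure h1 hp]
  exact toFun_smul' c f

theorem ofFun_add {φ ψ : G → ℂ} (hφ : MemLp φ (ENNReal.ofReal p) (weightedMeasure μ ω p))
    (hψ : MemLp ψ (ENNReal.ofReal p) (weightedMeasure μ ω p)) :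
    ofFun μ ω p (φ + ψ) = ofFun μ ω p φ + ofFun μ ω p ψ :=
  ext' ((toFun_ofFun' (hφ.add hψ)).trans
    (((toFun_ofFun' hφ).add (toFun_ofFun' hψ)).symm.trans (toFun_add' _ _).symm))

theorem ofFun_smul (c : ℂ) {φ : G → ℂ}
    (hφ : MemLp φ (ENNReal.ofReal p) (weightedMeasure μ ω p)) :
    ofFun μ ω p (c • φ) = c • ofFun μ ω p φ :=
  ext' ((toFun_ofFun' (hφ.const_smul c)).trans
    (((toFun_ofFun' hφ).const_smul c).symm.trans (toFun_smul' _ _).symm))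

theorem completeSpace : CompleteSpace (WeightedLp μ ω p) :=
  haveI := fact_one_le_ofReal p
  inferInstanceAs (CompleteSpace (Lp ℂ (ENNReal.ofReal p) (weightedMeasure μ ω p)))

end Basic

section Algebra

variable {G : Type*} [CommGroup G] [TopologicalSpace G] [IsTopologicalGroup G]
  [MeasurableSpace G] [BorelSpace G] {μ : Measure G} {ω : G → ℝ} {p q : ℝ}

theorem _root_.groupConvolution_congr_ae [μ.IsHaarMeasure] [μ.IsInvInvariant] {f f' g g' : G → ℂ}
    (hf : f =ᵐ[μ] f') (hg : g =ᵐ[μ] g') :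
    groupConvolution μ f g = groupConvolution μ f' g' := by
  funext x
  refine integral_congr_ae ?_
  filter_upwards [hf, (measurePreserving_inv_mul x).quasiMeasurePreserving.ae_eq_comp hg]
    with y h1 h2
  exact congrArg₂ (· * ·) h1 h2

theorem _root_.groupConvolution_comm [μ.IsHaarMeasure] [μ.IsInvInvariant] (f g : G → ℂ) :
    groupConvolution μ f g = groupConvolution μ g f := by
  funext x
  rw [groupConvolution, ← integral_div_left_eq_self _ μ x]
  refine integral_congr_ae (ae_of_all _ fun y => ?_)
  simp [div_eq_mul_inv, mul_comm]

theorem _root_.groupInvolution_groupConvolution [μ.IsHaarMeasure] (f g : G → ℂ) :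
    groupInvolution (groupConvolution μ f g) =
      groupConvolution μ (groupInvolution g) (groupInvolution f) := by
  funext x
  rw [groupConvolution, groupInvolution, groupConvolution, ← integral_conj,
    ← integral_mul_left_eq_self _ x⁻¹]
  refine integral_congr_ae (ae_of_all _ fun y => ?_)
  simp [groupInvolution, mul_comm]

theorem _root_.groupInvolution_congr_ae [μ.IsInvInvariant] {f g : G → ℂ}
    (h : f =ᵐ[μ] g) : groupInvolution f =ᵐ[μ] groupInvolution g := by
  filter_upwards [(Measure.measurePreserving_inv μ).quasiMeasurePreserving.ae_eq_comp h] with x hx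
  exact congrArg (starRingEnd ℂ) hx

theorem _root_.eLpNorm_groupInvolution [μ.IsInvInvariant] (hp : 0 < p)
    (hω : IsLPAlgWeight μ q ω) (f : G → ℂ) :
    eLpNorm (groupInvolution f) (ENNReal.ofReal p) (weightedMeasure μ ω p) =
      eLpNorm f (ENNReal.ofReal p) (weightedMeasure μ ω p) := by
  refine ENNReal.rpow_left_injective hp.ne' ?_
  beta_reduce
  rw [eLpNorm_weightedMeasure_rpow hω.measurable hω.one_le hp,
    eLpNorm_weightedMeasure_rpow hω.measurable hω.one_le hp,
    ← lintegral_inv_eq_self (fun x => (‖f x‖ₑ * ENNReal.ofReal (ω x)) ^ p)]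
  refine lintegral_congr fun x => ?_
  simp only [groupInvolution, hω.symmetric, RCLike.enorm_conj]

theorem _root_.MeasureTheory.MemLp.groupInvolution [μ.IsInvInvariant] (hp : 0 < p)
    (hω : IsLPAlgWeight μ q ω) {f : G → ℂ} (hf : Measurable f)
    (hfp : MemLp f (ENNReal.ofReal p) (weightedMeasure μ ω p)) :
    MemLp (groupInvolution f) (ENNReal.ofReal p) (weightedMeasure μ ω p) :=
  ⟨(Complex.continuous_conj.measurable.comp (hf.comp measurable_inv)).aestronglyMeasurable,
    (eLpNorm_groupInvolution hp hω f).trans_lt hfp.2⟩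

theorem toFun_star [μ.IsInvInvariant] (hp : 0 < p)
    (hω : IsLPAlgWeight μ q ω) (f : WeightedLp μ ω p) :
    (star f).toFun =ᵐ[μ] groupInvolution f.toFun :=
  toFun_ofFun hω.one_le hp.le (f.memLp_toFun.groupInvolution hp hω f.measurable_toFun)

theorem star_ofFun [μ.IsInvInvariant] (hp : 0 < p)
    (hω : IsLPAlgWeight μ q ω) {φ : G → ℂ} (hm : Measurable φ)
    (hφ : MemLp φ (ENNReal.ofReal p) (weightedMeasure μ ω p)) :
    star (ofFun μ ω p φ) = ofFun μ ω p (groupInvolution φ) :=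
  ext hω.one_le hp.le <| (toFun_star hp hω _).trans <|
    (groupInvolution_congr_ae (toFun_ofFun hω.one_le hp.le hφ)).trans
    (toFun_ofFun hω.one_le hp.le (hφ.groupInvolution hp hω hm)).symm

theorem norm_star [μ.IsInvInvariant] [Fact (1 < p)] (hp : 0 < p)
    (hω : IsLPAlgWeight μ q ω) (a : WeightedLp μ ω p) :
    ‖star a‖ = ‖a‖ := by
  change ‖ofFun μ ω p _‖ = _
  rw [norm_ofFun (a.memLp_toFun.groupInvolution hp hω a.measurable_toFun),
    eLpNorm_groupInvolution hp hω, norm_def]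

theorem star_add [μ.IsInvInvariant] [Fact (1 < p)] (hp : 0 < p)
    (hω : IsLPAlgWeight μ q ω) (a b : WeightedLp μ ω p) :
    star (a + b) = star a + star b := by
  refine ext hω.one_le hp.le ((toFun_star hp hω _).trans
    (((groupInvolution_congr_ae (toFun_add hω.one_le hp.le a b)).trans ?_).trans
      (toFun_add hω.one_le hp.le _ _).symm))
  filter_upwards [toFun_star hp hω a, toFun_star hp hω b] with x h1 h2
  rw [Pi.add_apply, h1, h2]
  simp [groupInvolution]

theorem star_smul [μ.IsInvInvariant] [Fact (1 < p)] (hp : 0 < p)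
    (hω : IsLPAlgWeight μ q ω) (z : ℂ) (a : WeightedLp μ ω p) :
    star (z • a) = starRingEnd ℂ z • star a := by
  refine ext hω.one_le hp.le ((toFun_star hp hω _).trans
    (((groupInvolution_congr_ae (toFun_smul hω.one_le hp.le z a)).trans ?_).trans
      (toFun_smul hω.one_le hp.le _ _).symm))
  filter_upwards [toFun_star hp hω a] with x h1
  rw [Pi.smul_apply, h1]
  simp [groupInvolution]

theorem star_star [μ.IsInvInvariant] (hp : 0 < p)
    (hω : IsLPAlgWeight μ q ω) (a : WeightedLp μ ω p) :
    star (star a) = a := by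
  refine ext hω.one_le hp.le ((toFun_star hp hω _).trans
    ((groupInvolution_congr_ae (toFun_star hp hω a)).trans (ae_of_all _ fun x => ?_)))
  simp [groupInvolution]

theorem mul_comm [μ.IsHaarMeasure] [μ.IsInvInvariant] (f g : WeightedLp μ ω p) : f * g = g * f := by
  change ofFun μ ω p _ = ofFun μ ω p _
  rw [groupConvolution_comm]

variable [T2Space G] [LocallyCompactSpace G] [SigmaCompactSpace G] [μ.IsHaarMeasure] [μ.Regular]

theorem toFun_mul (hpq : p.HolderConjugate q) (hω : IsLPAlgWeight μ q ω)
    (f g : WeightedLp μ ω p) :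
    (f * g).toFun =ᵐ[μ] groupConvolution μ f.toFun g.toFun :=
  toFun_ofFun hω.one_le hpq.nonneg
    (MemLp.groupConvolution hpq hω f.measurable_toFun g.measurable_toFun f.memLp_toFun
      g.memLp_toFun)

theorem ofFun_mul (hpq : p.HolderConjugate q) (hω : IsLPAlgWeight μ q ω) {φ ψ : G → ℂ}
    (hφm : Measurable φ) (hψm : Measurable ψ)
    (hφ : MemLp φ (ENNReal.ofReal p) (weightedMeasure μ ω p))
    (hψ : MemLp ψ (ENNReal.ofReal p) (weightedMeasure μ ω p)) :
    ofFun μ ω p φ * ofFun μ ω p ψ = ofFun μ ω p (groupConvolution μ φ ψ) := by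
  refine ext hω.one_le hpq.nonneg ((toFun_mul hpq hω _ _).trans ?_)
  rw [groupConvolution_congr_ae (toFun_ofFun hω.one_le hpq.nonneg hφ)
    (toFun_ofFun hω.one_le hpq.nonneg hψ)]
  exact (toFun_ofFun hω.one_le hpq.nonneg
    (MemLp.groupConvolution hpq hω hφm hψm hφ hψ)).symm

theorem star_mul (hpq : p.HolderConjugate q) (hω : IsLPAlgWeight μ q ω)
    (a b : WeightedLp μ ω p) : star (a * b) = star b * star a := by
  refine ext hω.one_le hpq.nonneg ((toFun_star hpq.pos hω _).trans
    ((groupInvolution_congr_ae (toFun_mul hpq hω a b)).trans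
      (EventuallyEq.trans ?_ (toFun_mul hpq hω _ _).symm)))
  rw [groupInvolution_groupConvolution, groupConvolution_congr_ae (toFun_star hpq.pos hω b)
    (toFun_star hpq.pos hω a)]

variable [Fact (1 < p)]

theorem add_mul (hpq : p.HolderConjugate q) (hω : IsLPAlgWeight μ q ω)
    (a b c : WeightedLp μ ω p) : (a + b) * c = a * c + b * c := by
  refine ext hω.one_le hpq.nonneg ((toFun_mul hpq hω _ _).trans
    (EventuallyEq.trans ?_ (toFun_add hω.one_le hpq.nonneg _ _).symm))
  rw [groupConvolution_congr_ae (toFun_add hω.one_le hpq.nonneg a b) EventuallyEq.rfl]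
  filter_upwards [toFun_mul hpq hω a c, toFun_mul hpq hω b c,
    ae_integrable_mul_inv_mul hpq hω a.measurable_toFun c.measurable_toFun a.memLp_toFun
      c.memLp_toFun,
    ae_integrable_mul_inv_mul hpq hω b.measurable_toFun c.measurable_toFun b.memLp_toFun
      c.memLp_toFun] with x h1 h2 h3 h4
  rw [Pi.add_apply, h1, h2, groupConvolution, groupConvolution, groupConvolution,
    ← integral_add h3 h4]
  simp only [Pi.add_apply, _root_.add_mul]

theorem smul_mul (hpq : p.HolderConjugate q) (hω : IsLPAlgWeight μ q ω) (z : ℂ)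
    (a b : WeightedLp μ ω p) : (z • a) * b = z • (a * b) := by
  refine ext hω.one_le hpq.nonneg ((toFun_mul hpq hω _ _).trans
    (EventuallyEq.trans ?_ (toFun_smul hω.one_le hpq.nonneg _ _).symm))
  rw [groupConvolution_congr_ae (toFun_smul hω.one_le hpq.nonneg z a) EventuallyEq.rfl]
  filter_upwards [toFun_mul hpq hω a b] with x h1
  rw [Pi.smul_apply, h1, groupConvolution, groupConvolution, ← integral_smul]
  simp only [Pi.smul_apply, smul_eq_mul, mul_assoc]

theorem norm_mul_le (hpq : p.HolderConjugate q) (hω : IsLPAlgWeight μ q ω)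
    (a b : WeightedLp μ ω p) : ‖a * b‖ ≤ ‖a‖ * ‖b‖ := by
  change ‖ofFun μ ω p _‖ ≤ _
  rw [norm_ofFun (MemLp.groupConvolution hpq hω a.measurable_toFun b.measurable_toFun
    a.memLp_toFun b.memLp_toFun), norm_def, norm_def, ← ENNReal.toReal_mul]
  exact ENNReal.toReal_mono (ENNReal.mul_ne_top a.memLp_toFun.2.ne b.memLp_toFun.2.ne)
    (eLpNorm_groupConvolution_le hpq hω a.measurable_toFun b.measurable_toFun b.memLp_toFun)

end Algebra

end WeightedLp

/-! ### Continuous functions with compact support -/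

/-- `f` is continuous with compact support. -/
structure IsCc {G : Type*} [TopologicalSpace G] (f : G → ℂ) : Prop where
  continuous : Continuous f
  hasCompactSupport : HasCompactSupport f

section WeightBound

variable {G : Type*} [MeasurableSpace G] {μ : Measure G} {ω : G → ℝ} {p : ℝ}

theorem eLpNorm_weightedMeasure_le (hω : Measurable ω) (h1 : ∀ x, 1 ≤ ω x) (hp : 0 < p)
    {f : G → ℂ} {M : ℝ}
    (hM : ∀ x, f x ≠ 0 → ω x ≤ M) :
    eLpNorm f (ENNReal.ofReal p) (weightedMeasure μ ω p) ≤
      ENNReal.ofReal M * eLpNorm f (ENNReal.ofReal p) μ := by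
  rw [← ENNReal.rpow_le_rpow_iff hp, eLpNorm_weightedMeasure_rpow hω h1 hp,
    ENNReal.mul_rpow_of_nonneg _ _ hp.le,
    eLpNorm_eq_lintegral_rpow_enorm_toReal (by simpa using hp) ENNReal.ofReal_ne_top,
    ENNReal.toReal_ofReal hp.le, ← ENNReal.rpow_mul, one_div_mul_cancel hp.ne', ENNReal.rpow_one,
    ← lintegral_const_mul' _ _ (ENNReal.rpow_ne_top_of_nonneg hp.le ENNReal.ofReal_ne_top)]
  refine lintegral_mono fun x => ?_
  rw [← ENNReal.mul_rpow_of_nonneg _ _ hp.le]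
  refine ENNReal.rpow_le_rpow ?_ hp.le
  by_cases hx : f x = 0
  · simp [hx]
  · rw [_root_.mul_comm]
    exact mul_le_mul_left (ENNReal.ofReal_le_ofReal (hM x hx)) _

end WeightBound

theorem groupConvolution_eq_zero {G : Type*} [CommGroup G] [MeasurableSpace G] {μ : Measure G}
    {f g : G → ℂ} {K L : Set G} (hK : ∀ x ∉ K, f x = 0) (hL : ∀ x ∉ L, g x = 0)
    {x : G} (hx : x ∉ K * L) : groupConvolution μ f g x = 0 := by
  refine integral_eq_zero_of_ae (ae_of_all _ fun y => ?_)
  by_cases hy : y ∈ K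
  · have : y⁻¹ * x ∉ L := fun h => hx ⟨y, hy, y⁻¹ * x, h, by simp⟩
    simp [hL _ this]
  · simp [hK _ hy]

namespace IsCc

variable {G : Type*} [TopologicalSpace G] {f g : G → ℂ}

theorem add (hf : IsCc f) (hg : IsCc g) : IsCc (f + g) :=
  ⟨hf.continuous.add hg.continuous, hf.hasCompactSupport.add hg.hasCompactSupport⟩

theorem const_smul (hf : IsCc f) (c : ℂ) : IsCc (c • f) :=
  ⟨hf.continuous.const_smul c, hf.hasCompactSupport.smul_left⟩

theorem groupInvolution [Group G] [IsTopologicalGroup G] (hf : IsCc f) :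
    IsCc (groupInvolution f) := by
  refine ⟨Complex.continuous_conj.comp (hf.continuous.comp continuous_inv), ?_⟩
  exact (hf.hasCompactSupport.comp_homeomorph (Homeomorph.inv G)).comp_left (map_zero _)

theorem conj (hf : IsCc f) : IsCc fun x => starRingEnd ℂ (f x) :=
  ⟨Complex.continuous_conj.comp hf.continuous, hf.hasCompactSupport.comp_left (map_zero _)⟩

theorem comp_mul_left [Group G] [IsTopologicalGroup G] (hf : IsCc f) (a : G) :
    IsCc fun x => f (a * x) :=
  ⟨hf.continuous.comp (by fun_prop), hf.hasCompactSupport.comp_homeomorph (Homeomorph.mulLeft a)⟩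

theorem comp_inv_mul [Group G] [IsTopologicalGroup G] (hf : IsCc f) (a : G) :
    IsCc fun x => f (x⁻¹ * a) :=
  ⟨hf.continuous.comp (by fun_prop),
    hf.hasCompactSupport.comp_homeomorph ((Homeomorph.inv G).trans (Homeomorph.mulRight a))⟩

variable [MeasurableSpace G] [BorelSpace G] {μ : Measure G}

theorem stronglyMeasurable [R1Space G] (hf : IsCc f) : StronglyMeasurable f :=
  hf.continuous.stronglyMeasurable_of_hasCompactSupport hf.hasCompactSupport

theorem integrable [IsFiniteMeasureOnCompacts μ] (hf : IsCc f) : Integrable f μ :=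
  hf.continuous.integrable_of_hasCompactSupport hf.hasCompactSupport

section Group

variable [CommGroup G] [IsTopologicalGroup G]

theorem groupConvolution [IsFiniteMeasureOnCompacts μ] [T2Space G]
    (hf : IsCc f) (hg : IsCc g) : IsCc (groupConvolution μ f g) := by
  have hf' := hf.continuous
  have hg' := hg.continuous
  refine ⟨?_, ?_⟩
  · rw [← continuousOn_univ]
    refine continuousOn_integral_of_compact_support (k := tsupport f) hf.hasCompactSupport
      (by fun_prop) fun x y _ hy => ?_
    rw [image_eq_zero_of_notMem_tsupport hy, zero_mul]
  · exact HasCompactSupport.intro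
      (hf.hasCompactSupport.isCompact.mul hg.hasCompactSupport.isCompact)
      fun x hx => groupConvolution_eq_zero (fun _ => image_eq_zero_of_notMem_tsupport)
        (fun _ => image_eq_zero_of_notMem_tsupport) hx

/-- Fubini's theorem for `∫ (f * g) k`. -/
theorem integral_groupConvolution_mul [IsFiniteMeasureOnCompacts μ]
    (hf : IsCc f) (hg : Continuous g) {k : G → ℂ} (hk : IsCc k) :
    ∫ x, _root_.groupConvolution μ f g x * k x ∂μ =
      ∫ y, f y * ∫ x, g (y⁻¹ * x) * k x ∂μ ∂μ := by
  have hf' := hf.continuous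
  have hk' := hk.continuous
  have hcont : Continuous (Function.uncurry fun x y => f y * g (y⁻¹ * x) * k x) := by
    unfold Function.uncurry; fun_prop
  have hcs : HasCompactSupport (Function.uncurry fun x y => f y * g (y⁻¹ * x) * k x) := by
    refine HasCompactSupport.intro
      (hk.hasCompactSupport.isCompact.prod hf.hasCompactSupport.isCompact) ?_
    rintro ⟨x, y⟩ hxy
    by_contra hne
    obtain ⟨h1, h2⟩ := mul_ne_zero_iff.1 hne
    exact hxy ⟨subset_tsupport _ h2, subset_tsupport _ (left_ne_zero_of_mul h1)⟩
  have := integral_integral_swap_of_hasCompactSupport hcont hcs (μ := μ) (ν := μ)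
  simp only [mul_assoc, integral_const_mul] at this
  rw [← this]
  refine integral_congr_ae (ae_of_all _ fun x => ?_)
  simp only [_root_.groupConvolution, ← integral_mul_const, mul_assoc]

theorem groupConvolution_assoc [μ.IsHaarMeasure] (hf : IsCc f) (hg : IsCc g)
    {k : G → ℂ} (hk : IsCc k) :
    _root_.groupConvolution μ (_root_.groupConvolution μ f g) k =
      _root_.groupConvolution μ f (_root_.groupConvolution μ g k) := by
  funext x
  rw [_root_.groupConvolution,
    integral_groupConvolution_mul hf hg.continuous (hk.comp_inv_mul x),
    _root_.groupConvolution]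
  refine integral_congr_ae (ae_of_all _ fun y => ?_)
  simp only [_root_.groupConvolution]
  rw [← integral_mul_left_eq_self _ y]
  simp only [inv_mul_cancel_left, mul_inv_rev, mul_assoc]

end Group

/-- For compactly supported continuous functions, membership in `L^p(G, ω)` comes from the local
boundedness of `ω`. -/
theorem memLp_weightedMeasure [R1Space G] [IsFiniteMeasureOnCompacts μ] {ω : G → ℝ} {p : ℝ}
    (hω : Measurable ω) (h1 : ∀ x, 1 ≤ ω x) (hp : 0 < p)
    (hloc : ∀ K : Set G, IsCompact K → ∃ M : ℝ, ∀ x ∈ K, ω x ≤ M) (hf : IsCc f) :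
    MemLp f (ENNReal.ofReal p) (weightedMeasure μ ω p) := by
  obtain ⟨M, hM⟩ := hloc _ hf.hasCompactSupport
  refine ⟨hf.stronglyMeasurable.aestronglyMeasurable, ?_⟩
  refine (eLpNorm_weightedMeasure_le hω h1 hp
    fun x hx => hM x (subset_tsupport _ hx)).trans_lt ?_
  exact ENNReal.mul_lt_top ENNReal.ofReal_lt_top
    (hf.continuous.memLp_of_hasCompactSupport hf.hasCompactSupport).2

end IsCc

section Density

variable {G : Type*} [TopologicalSpace G] [T2Space G] [SigmaCompactSpace G]
  [MeasurableSpace G] [BorelSpace G] {μ : Measure G} {ω : G → ℝ} {p : ℝ}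

theorem exists_isCompact_eLpNorm_sub_indicator_le (hω : Measurable ω) (h1 : ∀ x, 1 ≤ ω x)
    (hp : 0 < p) {f : G → ℂ} (hfm : StronglyMeasurable f)
    (hf : MemLp f (ENNReal.ofReal p) (weightedMeasure μ ω p)) {ε : ℝ≥0∞} (hε : ε ≠ 0) :
    ∃ K : Set G, IsCompact K ∧
      eLpNorm (f - K.indicator f) (ENNReal.ofReal p) (weightedMeasure μ ω p) ≤ ε := by
  set K : ℕ → Set G := compactCovering G
  have hK : ∀ n, IsCompact (K n) := isCompact_compactCovering G
  have hKm : ∀ n, MeasurableSet (K n) := fun n => (hK n).isClosed.measurableSet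
  have hlim : Tendsto (fun n => ∫⁻ x, (‖(f - (K n).indicator f) x‖ₑ * ENNReal.ofReal (ω x)) ^ p ∂μ)
      atTop (𝓝 (∫⁻ _, 0 ∂μ)) := by
    refine tendsto_lintegral_of_dominated_convergence
      (fun x => (‖f x‖ₑ * ENNReal.ofReal (ω x)) ^ p) (fun n => ?_) (fun n => ?_) ?_ ?_
    · exact ((hfm.sub (hfm.indicator (hKm n))).enorm.mul hω.ennreal_ofReal).pow_const p
    · refine ae_of_all _ fun x => ENNReal.rpow_le_rpow (mul_le_mul_left ?_ _) hp.le
      by_cases hx : x ∈ K n <;> simp [hx]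
    · rw [← eLpNorm_weightedMeasure_rpow hω h1 hp]
      exact ENNReal.rpow_ne_top_of_nonneg hp.le hf.2.ne
    · refine ae_of_all _ fun x => tendsto_const_nhds.congr' ?_
      obtain ⟨n, hn⟩ : ∃ n, x ∈ K n :=
        Set.mem_iUnion.1 (iUnion_compactCovering G ▸ Set.mem_univ x)
      filter_upwards [eventually_ge_atTop n] with m hm
      have hx : x ∈ K m := compactCovering_subset G hm hn
      simp [hx, hp]
  rw [lintegral_zero] at hlim
  have hεp : 0 < ε ^ p := ENNReal.rpow_pos_of_nonneg (pos_iff_ne_zero.2 hε) hp.le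
  obtain ⟨n, hn⟩ := (hlim.eventually (gt_mem_nhds hεp)).exists
  refine ⟨K n, hK n, ?_⟩
  rw [← eLpNorm_weightedMeasure_rpow hω h1 hp, ENNReal.rpow_lt_rpow_iff hp] at hn
  exact hn.le

/-- Continuous functions with compact support are dense in `L^p(G, ω)` if `ω` is locally
bounded. -/
theorem exists_isCc_eLpNorm_sub_le [LocallyCompactSpace G] [μ.Regular] (hω : Measurable ω)
    (h1 : ∀ x, 1 ≤ ω x) (hp : 1 ≤ p)
    (hloc : ∀ K : Set G, IsCompact K → ∃ M : ℝ, ∀ x ∈ K, ω x ≤ M)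
    {f : G → ℂ} (hfm : StronglyMeasurable f)
    (hf : MemLp f (ENNReal.ofReal p) (weightedMeasure μ ω p)) {ε : ℝ≥0∞} (hε : ε ≠ 0) :
    ∃ g : G → ℂ, IsCc g ∧
      eLpNorm (f - g) (ENNReal.ofReal p) (weightedMeasure μ ω p) ≤ ε := by
  have hp0 : 0 < p := zero_lt_one.trans_le hp
  have hε2 : ε / 2 ≠ 0 := by simpa using hε
  obtain ⟨K, hK, hKε⟩ := exists_isCompact_eLpNorm_sub_indicator_le hω h1 hp0 hfm hf hε2
  have hKm : MeasurableSet K := hK.isClosed.measurableSet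
  obtain ⟨θ, hθK, -, hθc, hθ01⟩ := exists_continuous_one_zero_of_isCompact hK isClosed_empty
    (disjoint_empty _)
  obtain ⟨M, hM⟩ := hloc _ hθc.isCompact
  set δ : ℝ≥0∞ := ε / 2 / ENNReal.ofReal (max M 1) with hδ
  have hM0 : ENNReal.ofReal (max M 1) ≠ 0 := by simp
  have hδ0 : δ ≠ 0 := by
    rw [hδ]; exact ENNReal.div_ne_zero.2 ⟨hε2, ENNReal.ofReal_ne_top⟩
  have hind : MemLp (K.indicator f) (ENNReal.ofReal p) μ :=
    (hf.mono_measure (le_weightedMeasure h1 hp0.le)).indicator hKm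
  obtain ⟨g, hgc, hgδ, hgcont, -⟩ :=
    hind.exists_hasCompactSupport_eLpNorm_sub_le ENNReal.ofReal_ne_top hδ0
  have hg : IsCc fun x => (θ x : ℂ) * g x := ⟨by fun_prop, hgc.mul_left⟩
  refine ⟨_, hg, ?_⟩
  -- Multiplication by the cutoff `θ` fixes `1_K f` and moves `g` into a set where `ω ≤ M`.
  have hsplit : f - (fun x => (θ x : ℂ) * g x) =
      (f - K.indicator f) + fun x => (θ x : ℂ) * (K.indicator f - g) x := by
    funext x
    by_cases hx : x ∈ K
    · simp [hx, hθK hx]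
    · simp [hx, sub_eq_add_neg]
  have hsecond : eLpNorm (fun x => (θ x : ℂ) * (K.indicator f - g) x) (ENNReal.ofReal p)
      (weightedMeasure μ ω p) ≤ ε / 2 := by
    calc _ ≤ ENNReal.ofReal (max M 1) *
          eLpNorm (fun x => (θ x : ℂ) * (K.indicator f - g) x) (ENNReal.ofReal p) μ := by
          refine eLpNorm_weightedMeasure_le hω h1 hp0 fun x hx => ?_
          refine (hM x (subset_tsupport _ ?_)).trans (le_max_left _ _)
          simpa using left_ne_zero_of_mul hx
      _ ≤ ENNReal.ofReal (max M 1) * eLpNorm (K.indicator f - g) (ENNReal.ofReal p) μ := by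
          refine mul_le_mul_right (eLpNorm_mono fun x => ?_) _
          rw [norm_mul, Complex.norm_real, Real.norm_of_nonneg (hθ01 x).1]
          exact mul_le_of_le_one_left (norm_nonneg _) (hθ01 x).2
      _ ≤ ENNReal.ofReal (max M 1) * δ := mul_le_mul_right hgδ _
      _ = ε / 2 := by
          rw [hδ, ENNReal.mul_div_cancel hM0 ENNReal.ofReal_ne_top]
  rw [hsplit]
  have hm1 : AEStronglyMeasurable (f - K.indicator f) (weightedMeasure μ ω p) :=
    (hfm.sub (hfm.indicator hKm)).aestronglyMeasurable
  have hm2 : AEStronglyMeasurable (fun x => (θ x : ℂ) * (K.indicator f - g) x)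
      (weightedMeasure μ ω p) := by
    have hθm : StronglyMeasurable θ := θ.continuous.stronglyMeasurable_of_hasCompactSupport hθc
    exact ((Complex.continuous_ofReal.comp_stronglyMeasurable hθm).mul
      ((hfm.indicator hKm).sub
        (hgcont.stronglyMeasurable_of_hasCompactSupport hgc))).aestronglyMeasurable
  calc _ ≤ _ := eLpNorm_add_le hm1 hm2 (ENNReal.one_le_ofReal.2 hp)
    _ ≤ ε / 2 + ε / 2 := add_le_add hKε hsecond
    _ = ε := ENNReal.add_halves ε

end Density

namespace WeightedLp

variable {G : Type*} [CommGroup G] [TopologicalSpace G] [IsTopologicalGroup G]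
  [T2Space G] [LocallyCompactSpace G] [SigmaCompactSpace G] [MeasurableSpace G] [BorelSpace G]
  {μ : Measure G} [μ.IsHaarMeasure] [μ.Regular] {ω : G → ℝ} {p q : ℝ} [Fact (1 < p)]

theorem dense_isCc (hpq : p.HolderConjugate q) (hω : IsLPAlgWeight μ q ω)
    (hloc : ∀ K : Set G, IsCompact K → ∃ M : ℝ, ∀ x ∈ K, ω x ≤ M) :
    Dense {a : WeightedLp μ ω p | ∃ φ : G → ℂ, IsCc φ ∧ a = ofFun μ ω p φ} := by
  refine Metric.dense_iff.2 fun a r hr => ?_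
  obtain ⟨φ, hφ, hle⟩ := exists_isCc_eLpNorm_sub_le hω.measurable hω.one_le hpq.lt.le hloc
    a.stronglyMeasurable_toFun a.memLp_toFun (ε := ENNReal.ofReal (r / 2)) (by simpa using hr)
  have hφp := hφ.memLp_weightedMeasure hω.measurable hω.one_le hpq.pos hloc (μ := μ)
  refine ⟨ofFun μ ω p φ, ?_, φ, hφ, rfl⟩
  have hsub : a - ofFun μ ω p φ = ofFun μ ω p (a.toFun - φ) := by
    have h := ofFun_add a.memLp_toFun (hφp.const_smul (-1 : ℂ))
    rw [ofFun_smul _ hφp, ofFun_toFun, neg_one_smul, neg_one_smul, ← sub_eq_add_neg,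
      ← sub_eq_add_neg] at h
    exact h.symm
  rw [Metric.mem_ball, dist_comm, dist_eq_norm, hsub, norm_ofFun (a.memLp_toFun.sub hφp)]
  calc _ ≤ (ENNReal.ofReal (r / 2)).toReal := ENNReal.toReal_mono ENNReal.ofReal_ne_top hle
    _ = r / 2 := ENNReal.toReal_ofReal (by positivity)
    _ < r := by linarith

theorem continuous_mul_right (hpq : p.HolderConjugate q) (hω : IsLPAlgWeight μ q ω)
    (b : WeightedLp μ ω p) : Continuous fun a : WeightedLp μ ω p => a * b :=
  continuous_of_linear_of_bound (𝕜 := ℂ) (fun a c => add_mul hpq hω a c b)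
    (fun z a => smul_mul hpq hω z a b) (C := ‖b‖) fun a => by
      rw [_root_.mul_comm]; exact norm_mul_le hpq hω a b

theorem continuous_mul_left (hpq : p.HolderConjugate q) (hω : IsLPAlgWeight μ q ω)
    (b : WeightedLp μ ω p) : Continuous fun a : WeightedLp μ ω p => b * a := by
  simpa only [mul_comm b] using continuous_mul_right hpq hω b

/-- Associativity holds on continuous functions with compact support by Fubini's theorem, and
extends to `L^p(G, ω)` by density. -/
theorem mul_assoc (hpq : p.HolderConjugate q) (hω : IsLPAlgWeight μ q ω)
    (hloc : ∀ K : Set G, IsCompact K → ∃ M : ℝ, ∀ x ∈ K, ω x ≤ M)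
    (a b c : WeightedLp μ ω p) : a * b * c = a * (b * c) := by
  have hd := dense_isCc (p := p) hpq hω hloc
  have hml : ∀ a : WeightedLp μ ω p, Continuous fun b : WeightedLp μ ω p => a * b :=
    continuous_mul_left hpq hω
  have hmr : ∀ a : WeightedLp μ ω p, Continuous fun b : WeightedLp μ ω p => b * a :=
    continuous_mul_right hpq hω
  have hL : ∀ {φ : G → ℂ}, IsCc φ → MemLp φ (ENNReal.ofReal p) (weightedMeasure μ ω p) :=
    fun hφ => hφ.memLp_weightedMeasure hω.measurable hω.one_le hpq.pos hloc
  have hM : ∀ {φ : G → ℂ}, IsCc φ → Measurable φ := fun hφ => hφ.stronglyMeasurable.measurable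
  refine hd.induction (P := fun a => a * b * c = a * (b * c)) ?_
    (isClosed_eq ((hmr c).comp (hmr b)) (hmr _)) a
  rintro _ ⟨φ, hφ, rfl⟩
  refine hd.induction (P := fun b => ofFun μ ω p φ * b * c = ofFun μ ω p φ * (b * c)) ?_
    (isClosed_eq ((hmr c).comp (hml _)) ((hml _).comp (hmr c))) b
  rintro _ ⟨ψ, hψ, rfl⟩
  refine hd.induction (P := fun c => ofFun μ ω p φ * ofFun μ ω p ψ * c =
    ofFun μ ω p φ * (ofFun μ ω p ψ * c)) ?_
    (isClosed_eq (hml _) ((hml _).comp (hml _))) c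
  rintro _ ⟨χ, hχ, rfl⟩
  have h1 := hφ.groupConvolution (μ := μ) hψ
  have h2 := hψ.groupConvolution (μ := μ) hχ
  rw [ofFun_mul hpq hω (hM hφ) (hM hψ) (hL hφ) (hL hψ),
    ofFun_mul hpq hω (hM hψ) (hM hχ) (hL hψ) (hL hχ),
    ofFun_mul hpq hω (hM h1) (hM hχ) (hL h1) (hL hχ),
    ofFun_mul hpq hω (hM hφ) (hM h2) (hL hφ) (hL h2), hφ.groupConvolution_assoc hψ hχ]

theorem isBanachStarAlgebra (hpq : p.HolderConjugate q) (hω : IsLPAlgWeight μ q ω)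
    (hloc : ∀ K : Set G, IsCompact K → ∃ M : ℝ, ∀ x ∈ K, ω x ≤ M) :
    IsBanachStarAlgebra (WeightedLp μ ω p) where
  complete := completeSpace
  mul_assoc := mul_assoc hpq hω hloc
  add_mul := add_mul hpq hω
  mul_add a b c := by rw [mul_comm a, add_mul hpq hω, mul_comm b, mul_comm c]
  smul_mul := smul_mul hpq hω
  mul_smul z a b := by rw [mul_comm a, smul_mul hpq hω, mul_comm b]
  norm_mul_le := norm_mul_le hpq hω
  star_star := star_star hpq.pos hω
  star_add := star_add hpq.pos hω
  star_smul := star_smul hpq.pos hω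
  star_mul := star_mul hpq hω
  norm_star := norm_star hpq.pos hω

end WeightedLp

/-! ### Gelfand theory for non-unital commutative Banach algebras -/

/-- In a commutative Banach algebra every point of the quasispectrum of `a` is the value at `a` of
a continuous multiplicative functional, the restriction of a character of the unitization. -/
theorem exists_multiplicative_functional_of_mem_quasispectrum {A : Type*}
    [NonUnitalNormedCommRing A] [NormedSpace ℂ A] [IsScalarTower ℂ A A] [SMulCommClass ℂ A A]
    [CompleteSpace A] {a : A} {z : ℂ} (hz : z ∈ quasispectrum ℂ a) :
    ∃ φ : A →L[ℂ] ℂ, (∀ b c, φ (b * c) = φ b * φ c) ∧ φ a = z := by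
  let _ : NormedCommRing (WithLp 1 (Unitization ℂ A)) :=
    { WithLp.instUnitizationNormedRing with
      mul_comm := fun x y => congrArg (WithLp.toLp 1) (mul_comm x.ofLp y.ofLp) }
  have hz' : z ∈ spectrum ℂ (WithLp.toLp 1 (a : Unitization ℂ A)) := by
    rw [Unitization.quasispectrum_eq_spectrum_inr] at hz
    rwa [← AlgEquiv.spectrum_eq (WithLp.unitizationAlgEquiv (𝕜 := ℂ) (A := A) ℂ)]
  obtain ⟨χ, hχ⟩ := WeakDual.CharacterSpace.mem_spectrum_iff_exists.1 hz'
  let ψ : A →ₗ[ℂ] ℂ :=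
    { toFun := fun b => χ (WithLp.toLp 1 (b : Unitization ℂ A))
      map_add' := fun b c => by
        rw [Unitization.inr_add, WithLp.toLp_add, map_add]
      map_smul' := fun r b => by
        rw [Unitization.inr_smul, WithLp.toLp_smul, map_smul]; rfl }
  have hψ : Continuous ψ := (map_continuous χ).comp
    (WithLp.unitization_isometry_inr (𝕜 := ℂ) (A := A)).continuous
  refine ⟨⟨ψ, hψ⟩, fun b c => ?_, hχ⟩
  change χ (WithLp.toLp 1 ((b * c : A) : Unitization ℂ A)) = _
  rw [Unitization.inr_mul]
  exact map_mul χ (WithLp.toLp 1 (b : Unitization ℂ A)) (WithLp.toLp 1 (c : Unitization ℂ A))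

/-- A commutative Banach `*`-algebra is symmetric if its characters respect the involution, since
then `φ (a^* a) = |φ a|²`. -/
theorem IsBanachStarAlgebra.isSymmetric_of_map_star {A : Type*} [NormedAddCommGroup A]
    [NormedSpace ℂ A] [Mul A] [Star A] (h : IsBanachStarAlgebra A)
    (hcomm : ∀ a b : A, a * b = b * a)
    (hstar : ∀ φ : A →L[ℂ] ℂ, (∀ b c, φ (b * c) = φ b * φ c) →
      ∀ a, φ (star a) = starRingEnd ℂ (φ a)) : h.IsSymmetric := by
  let _ : NonUnitalNormedCommRing A :=
    { (inferInstance : NormedAddCommGroup A), h.toNonUnitalRing with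
      norm_mul_le := h.norm_mul_le
      mul_comm := hcomm }
  have : IsScalarTower ℂ A A := ⟨fun z a b => h.smul_mul z a b⟩
  have : SMulCommClass ℂ A A := ⟨fun z a b => (h.mul_smul z a b).symm⟩
  have : CompleteSpace A := h.complete
  intro a z hz
  obtain ⟨φ, hφ, rfl⟩ := exists_multiplicative_functional_of_mem_quasispectrum hz
  refine ⟨Complex.normSq (φ a), Complex.normSq_nonneg _, ?_⟩
  rw [hφ (star a) a, hstar φ hφ, Complex.normSq_eq_conj_mul_self]

/-! ### Square-integral estimates for convolution by a Hermitian function -/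

namespace IsCc

section Basic

variable {G : Type*} [TopologicalSpace G] [MeasurableSpace G] [BorelSpace G] {μ : Measure G}
  [IsFiniteMeasureOnCompacts μ] {f g h : G → ℂ}

theorem integrable_mul (hf : IsCc f) (hg : Continuous g) : Integrable (fun x => f x * g x) μ :=
  (hf.continuous.mul hg).integrable_of_hasCompactSupport hf.hasCompactSupport.mul_right

theorem integrable_norm_sq (hf : IsCc f) : Integrable (fun x => ‖f x‖ ^ 2) μ := by
  refine (hf.integrable_mul hf.continuous (μ := μ)).norm.congr (ae_of_all _ fun x => ?_)
  simp only [norm_mul, sq]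

/-- The Cauchy–Schwarz inequality with a free parameter `R` in place of the geometric mean. -/
theorem norm_integral_mul_le (hf : IsCc f) (hg : IsCc g) {R : ℝ} (hR : 0 < R) :
    ‖∫ x, f x * g x ∂μ‖ ≤ (R⁻¹ * ∫ x, ‖f x‖ ^ 2 ∂μ + R * ∫ x, ‖g x‖ ^ 2 ∂μ) / 2 := by
  have hi : Integrable (fun x => (R⁻¹ * ‖f x‖ ^ 2 + R * ‖g x‖ ^ 2) / 2) μ :=
    ((hf.integrable_norm_sq.const_mul _).add (hg.integrable_norm_sq.const_mul _)).div_const 2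
  calc ‖∫ x, f x * g x ∂μ‖ ≤ ∫ x, ‖f x * g x‖ ∂μ := norm_integral_le_integral_norm _
    _ ≤ ∫ x, (R⁻¹ * ‖f x‖ ^ 2 + R * ‖g x‖ ^ 2) / 2 ∂μ := by
        refine integral_mono (hf.integrable_mul hg.continuous).norm hi fun x => ?_
        have h1 : R⁻¹ * ‖f x‖ ^ 2 + R * ‖g x‖ ^ 2 - 2 * (‖f x‖ * ‖g x‖) =
            R⁻¹ * (‖f x‖ - R * ‖g x‖) ^ 2 := by field_simp; ring
        have h2 : 0 ≤ R⁻¹ * (‖f x‖ - R * ‖g x‖) ^ 2 := by positivity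
        simp only [norm_mul]
        linarith
    _ = _ := by
        rw [integral_div, integral_add (hf.integrable_norm_sq.const_mul _)
          (hg.integrable_norm_sq.const_mul _), integral_const_mul, integral_const_mul]

end Basic

section Group

variable {G : Type*} [CommGroup G] [TopologicalSpace G] [IsTopologicalGroup G]
  [MeasurableSpace G] [BorelSpace G] {μ : Measure G} [μ.IsHaarMeasure] {f g h : G → ℂ}

/-- Young's inequality `‖h * g‖₂ ≤ ‖h‖₁ ‖g‖₂`. -/
theorem integral_norm_sq_groupConvolution_le [T2Space G] (hh : IsCc h) (hg : IsCc g)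
    {c : ℝ} (hc : 0 < c)
    (hhc : ∫ x, ‖h x‖ ∂μ ≤ c) :
    ∫ x, ‖_root_.groupConvolution μ h g x‖ ^ 2 ∂μ ≤ c ^ 2 * ∫ x, ‖g x‖ ^ 2 ∂μ := by
  set k := _root_.groupConvolution μ h g with hkdef
  have hk : IsCc k := hh.groupConvolution hg
  set N := ∫ x, ‖k x‖ ^ 2 ∂μ
  set S := ∫ x, ‖g x‖ ^ 2 ∂μ
  have hN0 : 0 ≤ N := integral_nonneg fun _ => by positivity
  have hS0 : 0 ≤ S := integral_nonneg fun _ => by positivity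
  have hNeq : (N : ℂ) = ∫ x, k x * starRingEnd ℂ (k x) ∂μ := by
    have h0 : (N : ℂ) = ∫ x, ((‖k x‖ ^ 2 : ℝ) : ℂ) ∂μ := integral_ofReal.symm
    rw [h0]
    refine integral_congr_ae (ae_of_all _ fun x => ?_)
    simp only [Complex.mul_conj, Complex.normSq_eq_norm_sq]
  rw [hkdef, integral_groupConvolution_mul hh hg.continuous hk.conj] at hNeq
  have hbound : ∀ y, ‖∫ x, g (y⁻¹ * x) * starRingEnd ℂ (k x) ∂μ‖ ≤ (c * S + c⁻¹ * N) / 2 := by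
    intro y
    refine (norm_integral_mul_le (hg.comp_mul_left y⁻¹) hk.conj (inv_pos.2 hc)).trans_eq ?_
    rw [integral_mul_left_eq_self (fun x => ‖g x‖ ^ 2) y⁻¹, inv_inv]
    simp only [RCLike.norm_conj, S, N]
  -- `N = ∫ h(y) ⟨τ_y g, k⟩ dy`, and the parameter `c⁻¹` lets half of `N` be absorbed on the left.
  have hle : N ≤ c * ((c * S + c⁻¹ * N) / 2) := by
    calc N = ‖(N : ℂ)‖ := by rw [Complex.norm_real, Real.norm_of_nonneg hN0]
      _ ≤ ∫ y, ‖h y‖ * ((c * S + c⁻¹ * N) / 2) ∂μ := by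
          rw [hNeq]
          refine norm_integral_le_of_norm_le (hh.integrable.norm.mul_const _)
            (ae_of_all _ fun y => ?_)
          rw [norm_mul]
          exact mul_le_mul_of_nonneg_left (hbound y) (norm_nonneg _)
      _ = (∫ y, ‖h y‖ ∂μ) * ((c * S + c⁻¹ * N) / 2) := integral_mul_const _ _
      _ ≤ c * ((c * S + c⁻¹ * N) / 2) := mul_le_mul_of_nonneg_right hhc (by positivity)
  have hcc : c * ((c * S + c⁻¹ * N) / 2) = (c ^ 2 * S + N) / 2 := by field_simp
  linarith

/-- Convolution by a Hermitian function is a symmetric operator on `L²`. -/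
theorem integral_groupConvolution_mul_conj_im [μ.IsInvInvariant] (hh : IsCc h) (hg : IsCc g)
    (hherm : _root_.groupInvolution h = h) :
    (∫ x, _root_.groupConvolution μ h g x * starRingEnd ℂ (g x) ∂μ).im = 0 := by
  rw [integral_groupConvolution_mul hh hg.continuous hg.conj, ← Complex.conj_eq_iff_im,
    ← integral_conj, ← integral_inv_eq_self]
  refine integral_congr_ae (ae_of_all _ fun y => ?_)
  have h1 : starRingEnd ℂ (h y⁻¹) = h y := congrFun hherm y
  simp only [map_mul, h1, inv_inv]
  rw [← integral_conj, ← integral_mul_left_eq_self _ y⁻¹]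
  simp only [mul_inv_cancel_left, map_mul, Complex.conj_conj]
  simp only [_root_.mul_comm]

/-- The operator bound `‖h + it‖² ≤ c² + t²` on `L²`: since convolution by `h` is symmetric, the
cross term of `h * g` and `itg` vanishes. -/
theorem integral_norm_sq_groupConvolution_add_le [T2Space G] [μ.IsInvInvariant] (hh : IsCc h)
    (hg : IsCc g) (hherm : _root_.groupInvolution h = h) {c : ℝ} (hc : 0 < c)
    (hhc : ∫ x, ‖h x‖ ∂μ ≤ c) (t : ℝ) :
    ∫ x, ‖(_root_.groupConvolution μ h g + (t * Complex.I : ℂ) • g) x‖ ^ 2 ∂μ ≤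
      (c ^ 2 + t ^ 2) * ∫ x, ‖g x‖ ^ 2 ∂μ := by
  have hk : IsCc (_root_.groupConvolution μ h g) := hh.groupConvolution hg
  have hY := integral_norm_sq_groupConvolution_le hh hg hc hhc
  have him := integral_groupConvolution_mul_conj_im hh hg hherm (μ := μ)
  set k := _root_.groupConvolution μ h g
  have hi : Integrable (fun x => k x * starRingEnd ℂ (g x)) μ :=
    hk.integrable_mul hg.conj.continuous
  have him' : ∫ x, (k x * starRingEnd ℂ (g x)).im ∂μ = 0 := by
    have := integral_im hi
    simpa [him] using this
  have hpt : ∀ x, ‖(k + (t * Complex.I : ℂ) • g) x‖ ^ 2 =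
      ‖k x‖ ^ 2 + t ^ 2 * ‖g x‖ ^ 2 + 2 * t * (k x * starRingEnd ℂ (g x)).im := by
    intro x
    simp only [Pi.add_apply, Pi.smul_apply, smul_eq_mul, Complex.sq_norm, Complex.normSq_apply,
      Complex.add_re, Complex.add_im, Complex.mul_re, Complex.mul_im, Complex.ofReal_re,
      Complex.ofReal_im, Complex.I_re, Complex.I_im, Complex.conj_re, Complex.conj_im]
    ring
  simp only [hpt]
  have hi1 : Integrable (fun x => t ^ 2 * ‖g x‖ ^ 2) μ := hg.integrable_norm_sq.const_mul _
  have hi2 : Integrable (fun x => ‖k x‖ ^ 2 + t ^ 2 * ‖g x‖ ^ 2) μ := hk.integrable_norm_sq.add hi1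
  have hi3 : Integrable (fun x => 2 * t * (k x * starRingEnd ℂ (g x)).im) μ := hi.im.const_mul _
  rw [integral_add hi2 hi3, integral_add hk.integrable_norm_sq hi1, integral_const_mul,
    integral_const_mul, him']
  linarith

end Group

end IsCc

/-! ### Subexponential growth -/

theorem exists_measure_pow_le_exp {G : Type*} [Group G] [MeasurableSpace G] {μ : Measure G}
    {U : Set G} {C Q : ℝ}
    (hgrowth : ∀ n : ℕ, 1 ≤ n → μ (U ^ n) ≤ ENNReal.ofReal (C * (n : ℝ) ^ Q))
    {ε : ℝ} (hε : 0 < ε) :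
    ∃ D : ℝ, 1 ≤ D ∧ ∀ n : ℕ, 1 ≤ n → μ (U ^ n) ≤ ENNReal.ofReal (D * Real.exp (ε * n)) := by
  have ho : Tendsto (fun n : ℕ => C * ((n : ℝ) ^ Q / Real.exp (ε * n))) atTop (𝓝 (C * 0)) :=
    (((isLittleO_rpow_exp_pos_mul_atTop Q hε).tendsto_div_nhds_zero).comp
      tendsto_natCast_atTop_atTop).const_mul C
  obtain ⟨D, hD⟩ := ho.bddAbove_range
  refine ⟨max D 1, le_max_right _ _, fun n hn => (hgrowth n hn).trans ?_⟩
  refine ENNReal.ofReal_le_ofReal ?_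
  have h1 : C * ((n : ℝ) ^ Q / Real.exp (ε * n)) ≤ D := hD ⟨n, rfl⟩
  have h2 : C * (n : ℝ) ^ Q ≤ D * Real.exp (ε * n) := by
    rwa [← mul_div_assoc, div_le_iff₀ (Real.exp_pos _)] at h1
  exact h2.trans (mul_le_mul_of_nonneg_right (le_max_left _ _) (Real.exp_pos _).le)

theorem le_of_forall_pow_le_const_mul_pow {a b C : ℝ} (hb : 0 < b)
    (h : ∀ m : ℕ, a ^ m ≤ C * b ^ m) : a ≤ b := by
  by_contra! hlt
  obtain ⟨m, hm⟩ := pow_unbounded_of_one_lt C ((one_lt_div hb).2 hlt)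
  rw [div_pow, lt_div_iff₀ (by positivity)] at hm
  exact absurd (h m) (not_le.2 hm)

theorem le_of_forall_le_exp_mul {a s : ℝ} (h : ∀ δ : ℝ, 0 < δ → a ≤ Real.exp δ * s) : a ≤ s := by
  have hc : Continuous fun δ : ℝ => Real.exp δ * s := by fun_prop
  have ht : Tendsto (fun δ : ℝ => Real.exp δ * s) (𝓝[>] 0) (𝓝 s) := by
    simpa using (hc.tendsto 0).mono_left nhdsWithin_le_nhds
  exact ge_of_tendsto ht (eventually_nhdsWithin_of_forall h)

/-! ### Characters of the weighted algebra -/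

namespace WeightedLp

/-- A bounded function vanishing off `L` has norm at most `sup_L ω · μ(L)^{1/p} · sup |φ|`, and
`μ(L)^{1/p} ≤ V` if `μ(L) ≤ V` and `V ≥ 1`. -/
theorem norm_ofFun_le {G : Type*} [MeasurableSpace G] {μ : Measure G} {ω : G → ℝ} {p : ℝ}
    [hp : Fact (1 < p)] (hω : Measurable ω)
    (h1 : ∀ x, 1 ≤ ω x) {φ : G → ℂ}
    (hφ : MemLp φ (ENNReal.ofReal p) (weightedMeasure μ ω p)) {L : Set G}
    (hφL : ∀ x ∉ L, φ x = 0) {M B V : ℝ} (hM : ∀ x ∈ L, ω x ≤ M) (hM0 : 0 ≤ M) (hB : 0 ≤ B)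
    (hφB : ∀ x, ‖φ x‖ ≤ B) (hV : 1 ≤ V) (hμ : μ L ≤ ENNReal.ofReal V) :
    ‖ofFun μ ω p φ‖ ≤ M * (V * B) := by
  have hp0 : 0 < p := zero_lt_one.trans hp.out
  have hsupp : Function.support φ ⊆ L := fun x hx => by
    by_contra h
    exact hx (hφL x h)
  rw [norm_ofFun hφ]
  refine ENNReal.toReal_le_of_le_ofReal (by positivity) ?_
  refine (eLpNorm_weightedMeasure_le hω h1 hp0 fun x hx => hM x (hsupp hx)).trans ?_
  rw [ENNReal.ofReal_mul hM0, ENNReal.ofReal_mul (zero_le_one.trans hV)]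
  refine mul_le_mul_right ?_ _
  rw [← eLpNorm_restrict_eq_of_support_subset hsupp]
  refine (eLpNorm_le_of_ae_bound (ae_of_all _ hφB)).trans (mul_le_mul_left ?_ _)
  rw [Measure.restrict_apply_univ, ENNReal.toReal_ofReal hp0.le]
  calc μ L ^ p⁻¹ ≤ ENNReal.ofReal V ^ p⁻¹ := ENNReal.rpow_le_rpow hμ (by positivity)
    _ ≤ ENNReal.ofReal V ^ (1 : ℝ) :=
        ENNReal.rpow_le_rpow_of_exponent_le (ENNReal.one_le_ofReal.2 hV)
          (inv_le_one_of_one_le₀ hp.out.le)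
    _ = ENNReal.ofReal V := ENNReal.rpow_one _

variable {G : Type*} [CommGroup G] [TopologicalSpace G] [IsTopologicalGroup G]
  [T2Space G] [LocallyCompactSpace G] [SigmaCompactSpace G] [MeasurableSpace G] [BorelSpace G]
  {μ : Measure G} [μ.IsHaarMeasure] [μ.Regular] {ω : G → ℝ} {p q : ℝ} [Fact (1 < p)]

/-- The functions `(h + it)^m * h`, with supports in `K^{m+1}` and controlled `L²` norms. -/
theorem exists_isCc_pow_add_mul (hpq : p.HolderConjugate q) (hω : IsLPAlgWeight μ q ω)
    (hloc : ∀ K : Set G, IsCompact K → ∃ M : ℝ, ∀ x ∈ K, ω x ≤ M)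
    {φ : WeightedLp μ ω p →L[ℂ] ℂ} (hφ : ∀ a b, φ (a * b) = φ a * φ b) {h : G → ℂ} (hh : IsCc h)
    (hherm : groupInvolution h = h) {c : ℝ} (hc : 0 < c) (hhc : ∫ x, ‖h x‖ ∂μ ≤ c) (t : ℝ)
    {K : Set G} (hK1 : (1 : G) ∈ K) (hK : ∀ x ∉ K, h x = 0) (m : ℕ) :
    ∃ g : G → ℂ, IsCc g ∧ (∀ x ∉ K ^ (m + 1), g x = 0) ∧
      ∫ x, ‖g x‖ ^ 2 ∂μ ≤ (c ^ 2 + t ^ 2) ^ m * ∫ x, ‖h x‖ ^ 2 ∂μ ∧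
      φ (ofFun μ ω p g) =
        (φ (ofFun μ ω p h) + t * Complex.I) ^ m * φ (ofFun μ ω p h) := by
  have hL : ∀ {φ : G → ℂ}, IsCc φ → MemLp φ (ENNReal.ofReal p) (weightedMeasure μ ω p) :=
    fun hφ => hφ.memLp_weightedMeasure hω.measurable hω.one_le hpq.pos hloc
  induction m with
  | zero => exact ⟨h, hh, by simpa using hK, by simp, by simp⟩
  | succ m ih =>
    obtain ⟨g, hg, hgK, hgN, hgφ⟩ := ih
    have hhg : IsCc (groupConvolution μ h g) := hh.groupConvolution hg
    refine ⟨groupConvolution μ h g + (t * Complex.I : ℂ) • g, hhg.add (hg.const_smul _),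
      fun x hx => ?_, ?_, ?_⟩
    · have h1 : x ∉ K * K ^ (m + 1) := by rwa [← pow_succ']
      have h2 : x ∉ K ^ (m + 1) := fun h =>
        hx (Set.pow_subset_pow_right hK1 (Nat.le_succ _) h)
      rw [Pi.add_apply, groupConvolution_eq_zero hK hgK h1, Pi.smul_apply, hgK x h2, smul_zero,
        add_zero]
    · refine (hh.integral_norm_sq_groupConvolution_add_le hg hherm hc hhc t).trans ?_
      rw [pow_succ' (c ^ 2 + t ^ 2), _root_.mul_assoc]
      exact mul_le_mul_of_nonneg_left hgN (by positivity)
    · rw [ofFun_add (hL hhg) ((hL hg).const_smul _), ofFun_smul _ (hL hg),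
        ← ofFun_mul hpq hω hh.stronglyMeasurable.measurable hg.stronglyMeasurable.measurable
          (hL hh) (hL hg), map_add, map_smul, hφ, hgφ, smul_eq_mul]
      ring

/-- The spectral estimate `|φ(h) + it|² ≤ c² + t²` for `c ≥ ‖h‖₁`: the supports of
`(h + it)^m * h` grow polynomially in measure and `ω` grows subexponentially on them, so only the
`L²` operator norm of `h + it` survives after taking `m`-th roots. -/
theorem norm_map_add_le (hpq : p.HolderConjugate q) (hω : IsLPAlgWeight μ q ω)
    (hS : ConditionS ω) {U : Set G} (hU : IsGeneratingNhd U) {C Q : ℝ}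
    (hgrowth : ∀ n : ℕ, 1 ≤ n → μ (U ^ n) ≤ ENNReal.ofReal (C * (n : ℝ) ^ Q))
    {φ : WeightedLp μ ω p →L[ℂ] ℂ} (hφ : ∀ a b, φ (a * b) = φ a * φ b) {h : G → ℂ} (hh : IsCc h)
    (hherm : groupInvolution h = h) {c : ℝ} (hc : 0 < c) (hhc : ∫ x, ‖h x‖ ∂μ ≤ c) (t : ℝ)
    (hne : φ (ofFun μ ω p h) ≠ 0) :
    ‖φ (ofFun μ ω p h) + t * Complex.I‖ ≤ √(c ^ 2 + t ^ 2) := by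
  have hloc : ∀ K : Set G, IsCompact K → ∃ M : ℝ, ∀ x ∈ K, ω x ≤ M := fun K =>
    hS.exists_le_of_isCompact hω.one_le hU
  have hL : ∀ {φ : G → ℂ}, IsCc φ → MemLp φ (ENNReal.ofReal p) (weightedMeasure μ ω p) :=
    fun hφ => hφ.memLp_weightedMeasure hω.measurable hω.one_le hpq.pos hloc
  set l := φ (ofFun μ ω p h) with hl
  set s := √(c ^ 2 + t ^ 2) with hs
  have hs0 : 0 < s := Real.sqrt_pos.2 (by positivity)
  have hs2 : s ^ 2 = c ^ 2 + t ^ 2 := Real.sq_sqrt (by positivity)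
  set K : Set G := insert 1 (tsupport h) with hKdef
  have hK : IsCompact K := hh.hasCompactSupport.isCompact.insert 1
  have hK1 : (1 : G) ∈ K := Set.mem_insert _ _
  have hKh : ∀ x ∉ K, h x = 0 := fun x hx =>
    image_eq_zero_of_notMem_tsupport fun h' => hx (Set.mem_insert_of_mem _ h')
  obtain ⟨r, hr⟩ := hU.exists_subset_pow hK
  set S := ∫ x, ‖h x‖ ^ 2 ∂μ with hSdef
  have hS0 : 0 ≤ S := integral_nonneg fun _ => by positivity
  refine le_of_forall_le_exp_mul fun δ hδ => ?_
  -- With `n = (r + 1)(m + 2)`, this choice makes `e^{εn} e^{εn} = e^{2δ} (e^δ)^m`.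
  set ε : ℝ := δ / (2 * (r + 1)) with hεdef
  have hε : 0 < ε := by positivity
  obtain ⟨M, hM0, hM⟩ := hS.exists_le_exp hω.one_le hU hε
  obtain ⟨D, hD1, hD⟩ := exists_measure_pow_le_exp hgrowth hε
  refine le_of_forall_pow_le_const_mul_pow (C := ‖φ‖ * M * D * S * Real.exp (2 * δ) / ‖l‖ ^ 2)
    (by positivity) fun m => ?_
  obtain ⟨g, hg, hgK, hgN, hgφ⟩ :=
    exists_isCc_pow_add_mul hpq hω hloc hφ hh hherm hc hhc t hK1 hKh m
  set k := groupConvolution μ g h with hk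
  have hkc : IsCc k := hg.groupConvolution hh
  have hkφ : φ (ofFun μ ω p k) = (l + t * Complex.I) ^ m * l * l := by
    rw [hk, ← ofFun_mul hpq hω hg.stronglyMeasurable.measurable hh.stronglyMeasurable.measurable
      (hL hg) (hL hh), hφ, hgφ]
  have hkB : ∀ x, ‖k x‖ ≤ s ^ m * S := by
    intro x
    -- The weight `s^m` balances `‖g‖₂² ≤ s^{2m} S` against `‖h‖₂² = S`.
    refine (hg.norm_integral_mul_le (hh.comp_inv_mul x) (pow_pos hs0 m)).trans ?_
    have h1 : ∫ y, ‖h (y⁻¹ * x)‖ ^ 2 ∂μ = S := by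
      simpa only [inv_mul_eq_div] using integral_div_left_eq_self (fun y => ‖h y‖ ^ 2) μ x
    have h2 : (s ^ m)⁻¹ * ∫ y, ‖g y‖ ^ 2 ∂μ ≤ s ^ m * S := by
      rw [inv_mul_le_iff₀ (pow_pos hs0 m)]
      refine hgN.trans_eq ?_
      rw [← hs2]; ring
    rw [h1]
    linarith
  have hkK : ∀ x ∉ K ^ (m + 2), k x = 0 := fun x hx =>
    groupConvolution_eq_zero hgK hKh (by rwa [← pow_succ])
  set n : ℕ := (r + 1) * (m + 2) with hn
  have hKn : K ^ (m + 2) ⊆ U ^ n := by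
    rw [hn, pow_mul]
    exact Set.pow_subset_pow_left (hr.trans (hU.pow_mono r.le_succ))
  have hn1 : 1 ≤ n := Nat.mul_pos r.succ_pos (by omega)
  have hexp : 1 ≤ Real.exp (ε * n) := Real.one_le_exp (by positivity)
  have hnorm : ‖ofFun μ ω p k‖ ≤
      M * Real.exp (ε * n) * (D * Real.exp (ε * n) * (s ^ m * S)) :=
    norm_ofFun_le hω.measurable hω.one_le (hL hkc) hkK
      (fun x hx => hM n x (hKn hx)) (by positivity) (by positivity) hkB
      (one_le_mul_of_one_le_of_one_le hD1 hexp) ((measure_mono hKn).trans (hD n hn1))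
  have hexp2 : Real.exp (ε * n) * Real.exp (ε * n) = Real.exp (2 * δ) * Real.exp δ ^ m := by
    rw [← Real.exp_add, ← Real.exp_nat_mul, ← Real.exp_add]
    congr 1
    rw [hn, hεdef]
    push_cast
    field_simp
    ring
  have hl2 : 0 < ‖l‖ ^ 2 := by positivity
  rw [div_mul_eq_mul_div, le_div_iff₀ hl2]
  calc ‖l + t * Complex.I‖ ^ m * ‖l‖ ^ 2 = ‖φ (ofFun μ ω p k)‖ := by
        rw [hkφ, norm_mul, norm_mul, norm_pow]; ring
    _ ≤ ‖φ‖ * ‖ofFun μ ω p k‖ := φ.le_opNorm _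
    _ ≤ ‖φ‖ * (M * Real.exp (ε * n) * (D * Real.exp (ε * n) * (s ^ m * S))) :=
        mul_le_mul_of_nonneg_left hnorm (norm_nonneg _)
    _ = ‖φ‖ * M * D * S * (Real.exp (ε * n) * Real.exp (ε * n)) * s ^ m := by ring
    _ = ‖φ‖ * M * D * S * Real.exp (2 * δ) * (Real.exp δ * s) ^ m := by
        rw [hexp2, mul_pow]; ring

/-- Characters are real on Hermitian functions: `|φ(h) + it|² ≤ c² + t²` for all real `t` is only
possible if `φ(h)` is real. -/
theorem map_ofFun_im_eq_zero (hpq : p.HolderConjugate q) (hω : IsLPAlgWeight μ q ω)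
    (hS : ConditionS ω) {U : Set G} (hU : IsGeneratingNhd U) {C Q : ℝ}
    (hgrowth : ∀ n : ℕ, 1 ≤ n → μ (U ^ n) ≤ ENNReal.ofReal (C * (n : ℝ) ^ Q))
    {φ : WeightedLp μ ω p →L[ℂ] ℂ} (hφ : ∀ a b, φ (a * b) = φ a * φ b) {h : G → ℂ} (hh : IsCc h)
    (hherm : groupInvolution h = h) : (φ (ofFun μ ω p h)).im = 0 := by
  by_cases hne : φ (ofFun μ ω p h) = 0
  · simp [hne]
  set c : ℝ := ∫ x, ‖h x‖ ∂μ + 1 with hcdef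
  have hc : 0 < c := by
    have : 0 ≤ ∫ x, ‖h x‖ ∂μ := integral_nonneg fun _ => norm_nonneg _
    linarith
  have key : ∀ t : ℝ, (φ (ofFun μ ω p h)).im ^ 2 + 2 * (φ (ofFun μ ω p h)).im * t ≤ c ^ 2 := by
    intro t
    have h1 := norm_map_add_le hpq hω hS hU hgrowth hφ hh hherm hc (by linarith) t hne
    have h2 := pow_le_pow_left₀ (norm_nonneg _) h1 2
    rw [Real.sq_sqrt (by positivity), Complex.sq_norm, Complex.normSq_apply] at h2
    simp only [Complex.add_re, Complex.add_im, Complex.mul_re, Complex.mul_im, Complex.ofReal_re,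
      Complex.ofReal_im, Complex.I_re, Complex.I_im] at h2
    nlinarith [sq_nonneg (φ (ofFun μ ω p h)).re]
  by_contra hb
  -- The left side of `key` is affine in `t`, so its slope vanishes.
  have h3 := key (c ^ 2 / (2 * (φ (ofFun μ ω p h)).im))
  have h4 : 2 * (φ (ofFun μ ω p h)).im * (c ^ 2 / (2 * (φ (ofFun μ ω p h)).im)) = c ^ 2 := by
    field_simp
  have h5 : 0 < (φ (ofFun μ ω p h)).im ^ 2 := by positivity
  linarith

/-- Characters of `L^p(G, ω)` respect the involution. -/
theorem map_star_of_mul (hpq : p.HolderConjugate q) (hω : IsLPAlgWeight μ q ω)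
    (hS : ConditionS ω) {U : Set G} (hU : IsGeneratingNhd U) {C Q : ℝ}
    (hgrowth : ∀ n : ℕ, 1 ≤ n → μ (U ^ n) ≤ ENNReal.ofReal (C * (n : ℝ) ^ Q))
    {φ : WeightedLp μ ω p →L[ℂ] ℂ} (hφ : ∀ a b, φ (a * b) = φ a * φ b) (a : WeightedLp μ ω p) :
    φ (star a) = starRingEnd ℂ (φ a) := by
  have hloc : ∀ K : Set G, IsCompact K → ∃ M : ℝ, ∀ x ∈ K, ω x ≤ M := fun K =>
    hS.exists_le_of_isCompact hω.one_le hU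
  have hL : ∀ {φ : G → ℂ}, IsCc φ → MemLp φ (ENNReal.ofReal p) (weightedMeasure μ ω p) :=
    fun hφ => hφ.memLp_weightedMeasure hω.measurable hω.one_le hpq.pos hloc
  have hcont : Continuous fun a : WeightedLp μ ω p => star a := by
    have hsub : ∀ a b : WeightedLp μ ω p, star (a - b) = star a - star b := fun a b => by
      rw [eq_sub_iff_add_eq, ← star_add hpq.pos hω, sub_add_cancel]
    refine (Isometry.of_dist_eq fun a b => ?_).continuous
    rw [dist_eq_norm, dist_eq_norm, ← hsub, norm_star hpq.pos hω]
  refine (dense_isCc hpq hω hloc).induction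
    (P := fun a : WeightedLp μ ω p => φ (star a) = starRingEnd ℂ (φ a)) ?_
    (isClosed_eq (φ.continuous.comp hcont) (Complex.continuous_conj.comp φ.continuous)) a
  rintro _ ⟨f, hf, rfl⟩
  have hf' := hf.groupInvolution
  rw [star_ofFun hpq.pos hω hf.stronglyMeasurable.measurable (hL hf)]
  -- `f + f^*` and `i (f - f^*)` are Hermitian.
  have h1 : (φ (ofFun μ ω p (f + groupInvolution f))).im = 0 := by
    refine map_ofFun_im_eq_zero hpq hω hS hU hgrowth hφ (hf.add hf') ?_
    funext x
    simp [groupInvolution, add_comm]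
  have h2 : (φ (ofFun μ ω p (Complex.I • (f + (-1 : ℂ) • groupInvolution f)))).im = 0 := by
    refine map_ofFun_im_eq_zero hpq hω hS hU hgrowth hφ
      ((hf.add (hf'.const_smul _)).const_smul _) ?_
    funext x
    simp [groupInvolution]
    ring
  rw [ofFun_add (hL hf) (hL hf'), map_add, Complex.add_im] at h1
  rw [ofFun_smul _ ((hL hf).add ((hL hf').const_smul _)), ofFun_add (hL hf)
    ((hL hf').const_smul _), ofFun_smul _ (hL hf'), map_smul, map_add, map_smul] at h2
  simp at h2
  apply Complex.ext
  · rw [Complex.conj_re]; linarith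
  · rw [Complex.conj_im]; linarith

end WeightedLp

theorem mainTheorem1 {G : Type*} [CommGroup G] [TopologicalSpace G] [IsTopologicalGroup G]
    [T2Space G] [LocallyCompactSpace G] [MeasurableSpace G] [BorelSpace G]
    (μ : Measure G) [μ.IsHaarMeasure] [μ.Regular] (hG : HasPolynomialGrowth μ)
    (p q : ℝ) [Fact (1 < p)] (hpq : 1 / p + 1 / q = 1)
    (ω : G → ℝ) (hω : IsLPAlgWeight μ q ω) :
    (∀ U : Set G, IsGeneratingNhd U →
      (ConditionS ω ↔
        ∀ ε : ℝ, 0 < ε → ∃ C : ℝ, ∀ x : G, ω x ≤ C * Real.exp (ε * wordLength U x))) ∧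
    (ConditionS ω →
      (∀ f g : WeightedLp μ ω p,
        (∀ᵐ x ∂μ, Integrable (fun y => f.toFun y * g.toFun (y⁻¹ * x)) μ) ∧
        (f * g).toFun =ᵐ[μ] groupConvolution μ f.toFun g.toFun) ∧
      (∀ f : WeightedLp μ ω p, (star f).toFun =ᵐ[μ] groupInvolution f.toFun) ∧
      ∃ h : IsBanachStarAlgebra (WeightedLp μ ω p), h.IsSymmetric) := by
  refine ⟨fun U hU => conditionS_iff_wordLength hω.one_le hU, fun hS => ?_⟩
  obtain ⟨U, hU, C, Q, hgrowth⟩ := hG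
  have hpq' : p.HolderConjugate q :=
    Real.holderConjugate_iff.2 ⟨Fact.out, by simpa only [one_div] using hpq⟩
  have := hU.sigmaCompactSpace
  have hloc : ∀ K : Set G, IsCompact K → ∃ M : ℝ, ∀ x ∈ K, ω x ≤ M := fun K =>
    hS.exists_le_of_isCompact hω.one_le hU
  refine ⟨fun f g => ⟨ae_integrable_mul_inv_mul hpq' hω f.measurable_toFun g.measurable_toFun
    f.memLp_toFun g.memLp_toFun, WeightedLp.toFun_mul hpq' hω f g⟩,
    WeightedLp.toFun_star hpq'.pos hω, WeightedLp.isBanachStarAlgebra hpq' hω hloc, ?_⟩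
  exact IsBanachStarAlgebra.isSymmetric_of_map_star _ WeightedLp.mul_comm
    fun φ hφ => WeightedLp.map_star_of_mul hpq' hω hS hU hgrowth hφ
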